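/- A matroid $\mathrm M$ is a finite nonempty lattice $\mathcal L$ with least element $\emptyset$ and greatest element $E$ such that: every element is the join of the atoms below it; for every $F\in\mathcal L$ all maximal chains of the interval $[\emptyset,F]$ have the same length, called $\operatorname{rk}(F)$; and $\operatorname{rk}(F\vee G)+\operatorname{rk}(F\wedge G)\le \operatorname{rk}(F)+\operatorname{rk}(G)$ for all $F,G\in\mathcal L$. The elements of $\mathcal L$ are called flats, $\overline{\mathcal L}=\mathcal L\setminus\{\emptyset\}$, and the rank of $\mathrm M$ is $\operatorname{rk}(E)$. The augmented Chow ring of $\mathrm M$ is $$A^\bullet(\mathrm M)=\mathbb Z[h_F]_{F\in\overline{\mathcal L}}\,/\,I,$$ where $I$ is the ideal generated by $(h_F-h_{G\vee F})(h_G-h_{G\vee F})$ for $F,G\in\overline{\mathcal L}$, and by $h_a^2$ and $h_ah_F-h_ah_{F\vee a}$ for $a$ an atom and $F\in\overline{\mathcal L}$. It is graded with each $h_F$ in degree $1$. **Theorem.** Let $\mathrm M$ be a matroid of rank $r$. Then: 1. (SM) The monomials $h_{F_1}^{a_1}\cdots h_{F_\ell}^{a_\ell}$, where $\ell\ge 0$,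 $\emptyset<F_1<\cdots<F_\ell$ is a chain of flats, and the exponents are positive integers with $a_1\le\operatorname{rk}(F_1)$ and $a_i<\operatorname{rk}(F_i)-\operatorname{rk}(F_{i-1})$ for $2\le i\le\ell$, form a $\mathbb Z$-basis of $A^\bullet(\mathrm M)$ (distinct monomials giving distinct basis elements). 2. (HR) There is an isomorphism of abelian groups $\deg\colon A^r(\mathrm M)\to\mathbb Z$ such that for all $F_1,\dots,F_r\in\overline{\mathcal L}$, $$\deg(h_{F_1}\cdots h_{F_r})=\begin{cases}1 & \text{if } \operatorname{rk}\bigl(\bigvee_{i\in T}F_i\bigr)\ge |T| \text{ for all } T\subseteq\{1,\dots,r\},\\ 0&\text{otherwise,}\end{cases}$$ where the empty join is $\emptyset$. 3. (PD) With this $\deg$, for all integers $0\le k\le r$ the pairing $A^k(\mathrm M)\times A^{r-k}(\mathrm M)\to\mathbb Z$, $(a,b)\mapsto\deg(ab)$, is unimodular, i.e. it defines an isomorphism $A^k(\mathrm M)\to\operatorname{Hom}(A^{r-k}(\mathrm M),\mathbb Z)$. -/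

import Mathlib

noncomputable section

namespace LatticeMatroid

/-- The rank of an element `F` of a finite lattice: the largest length of a chain
`F_0 < F_1 < ... < F_n = F` that ends at `F` (and then starts at `⊥`).
In a ranked lattice all maximal chains of `[⊥, F]` have this length. -/
def rk {L : Type*} [Lattice L] (F : L) : ℕ := (Order.height F).toNat

/-- A matroid, given by its lattice of flats: a finite nonempty atomic ranked lattice
whose rank function is submodular. (A finite nonempty lattice has a least element `⊥` and a
greatest element `⊤`.) A `Flag` is a maximal chain; the length of a finite chain is its
number of elements minus one. -/
structure IsMatroid (L : Type*) [Lattice L] [BoundedOrder L] : Prop where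
  finite : Finite L
  atomic : ∀ F : L, IsLUB {a : L | IsAtom a ∧ a ≤ F} F
  ranked : ∀ (F : L) (C : Flag (Set.Icc (⊥ : L) F)), (C : Set (Set.Icc (⊥ : L) F)).ncard = rk F + 1
  submodular : ∀ F G : L, rk (F ⊔ G) + rk (F ⊓ G) ≤ rk F + rk G

/-- The flats different from the least flat. -/
abbrev NonemptyFlat (L : Type*) [Lattice L] [BoundedOrder L] : Type _ := {F : L // F ≠ ⊥}

instance {L : Type*} [Lattice L] [BoundedOrder L] : Max (NonemptyFlat L) :=
  ⟨fun F G => ⟨F.1 ⊔ G.1, fun h => F.2 (sup_eq_bot_iff.mp h).1⟩⟩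

section ChowRing

variable (L : Type*) [Lattice L] [BoundedOrder L]

open MvPolynomial in
/-- The ideal of relations of the augmented Chow ring. -/
def augChowIdeal : Ideal (MvPolynomial (NonemptyFlat L) ℤ) :=
  Ideal.span
    ({p | ∃ F G : NonemptyFlat L, p = (X F - X (G ⊔ F)) * (X G - X (G ⊔ F))} ∪
     {p | ∃ a : NonemptyFlat L, IsAtom a.1 ∧ p = X a ^ 2} ∪
     {p | ∃ a F : NonemptyFlat L, IsAtom a.1 ∧ p = X a * X F - X a * X (F ⊔ a)})

/-- The augmented Chow ring `A(M)`. -/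
abbrev AugChowRing : Type _ := MvPolynomial (NonemptyFlat L) ℤ ⧸ augChowIdeal L

/-- The quotient map from the polynomial ring, as an additive (i.e. `ℤ`-linear) map. -/
def augChowMk : MvPolynomial (NonemptyFlat L) ℤ →ₗ[ℤ] AugChowRing L :=
  (Ideal.Quotient.mk (augChowIdeal L)).toAddMonoidHom.toIntLinearMap

/-- The generator `h_F`. -/
def h {L : Type*} [Lattice L] [BoundedOrder L] (F : NonemptyFlat L) : AugChowRing L :=
  Ideal.Quotient.mk (augChowIdeal L) (MvPolynomial.X F)

/-- The graded piece `A^k(M)`, each `h_F` having degree `1`: the image of the homogeneous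
polynomials of degree `k`. -/
def augChowGrade (k : ℕ) : Submodule ℤ (AugChowRing L) :=
  (MvPolynomial.homogeneousSubmodule (NonemptyFlat L) ℤ k).map (augChowMk L)

end ChowRing

variable {L : Type*} [Lattice L] [BoundedOrder L]

theorem mul_mem_augChowGrade {k l : ℕ} {x y : AugChowRing L}
    (hx : x ∈ augChowGrade L k) (hy : y ∈ augChowGrade L l) :
    x * y ∈ augChowGrade L (k + l) := by
  obtain ⟨p, hp, rfl⟩ := hx
  obtain ⟨q, hq, rfl⟩ := hy
  exact ⟨p * q, MvPolynomial.IsHomogeneous.mul hp hq,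
    map_mul (Ideal.Quotient.mk (augChowIdeal L)) p q⟩

theorem prod_h_mem_augChowGrade {n : ℕ} (F : Fin n → NonemptyFlat L) :
    ∏ i, h (F i) ∈ augChowGrade L n := by
  refine ⟨∏ i, MvPolynomial.X (F i), ?_, map_prod (Ideal.Quotient.mk (augChowIdeal L)) _ _⟩
  have := MvPolynomial.IsHomogeneous.prod Finset.univ
    (fun i => (MvPolynomial.X (F i) : MvPolynomial (NonemptyFlat L) ℤ)) (fun _ => 1)
    (fun i _ => MvPolynomial.isHomogeneous_X ℤ (F i))
  simpa using this

/-- An exponent vector `m` is standard if the monomial `h^m` is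
`h_{F_1}^{a_1} ... h_{F_n}^{a_n}` for a chain `⊥ < F_1 < ... < F_n` and positive exponents with
`a_1 ≤ rk F_1` and `a_i < rk F_i - rk F_{i-1}` for `2 ≤ i ≤ n`. (The case `n = 0` is allowed.) -/
def IsStandard (m : NonemptyFlat L →₀ ℕ) : Prop :=
  ∃ (n : ℕ) (F : Fin n → NonemptyFlat L) (a : Fin n → ℕ),
    StrictMono F ∧ (∀ i, 0 < a i) ∧
    (∀ i : Fin n, i.val = 0 → a i ≤ rk (F i).1) ∧
    (∀ i j : Fin n, i.val = j.val + 1 → (a i : ℤ) < (rk (F i).1 : ℤ) - rk (F j).1) ∧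
    m = ∑ i, Finsupp.single (F i) (a i)

/-- The element `h^m` of the augmented Chow ring. -/
def hMonomial (m : NonemptyFlat L →₀ ℕ) : AugChowRing L := m.prod fun F a => h F ^ a

/-- The Hall--Rado condition for a family of `n` nonempty flats. -/
def HallRado {n : ℕ} (F : Fin n → NonemptyFlat L) : Prop :=
  ∀ T : Finset (Fin n), T.card ≤ rk (T.sup fun i => (F i).1)

/-- The pairing `A^k(M) × A^l(M) → ℤ`, `(a, b) ↦ deg (a b)`, for `k + l = r`, as the map
`A^k(M) → Hom(A^l(M), ℤ)`. -/
def degPairing {r : ℕ} (deg : augChowGrade L r →ₗ[ℤ] ℤ) {k l : ℕ} (hkl : k + l = r) :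
    augChowGrade L k →ₗ[ℤ] (augChowGrade L l →ₗ[ℤ] ℤ) :=
  LinearMap.mk₂ ℤ
    (fun a b => deg ⟨(a : AugChowRing L) * b, hkl ▸ mul_mem_augChowGrade a.2 b.2⟩)
    (fun a a' b => by
      rw [← map_add]; congr 1; ext; exact add_mul (a : AugChowRing L) a' b)
    (fun c a b => by
      rw [← map_smul]; congr 1; ext; exact smul_mul_assoc c (a : AugChowRing L) b)
    (fun a b b' => by
      rw [← map_add]; congr 1; ext; exact mul_add (a : AugChowRing L) b b')
    (fun c a b => by
      rw [← map_smul]; congr 1; ext; exact mul_smul_comm c (a : AugChowRing L) b)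

end LatticeMatroid

end

/-!
The degree functional is written down on monomials of the polynomial ring as the indicator of the
Hall--Rado condition, and it is checked to kill the relations (`polyDeg_eq_zero`). For this, view a
monomial as a multiset `s` of flats and let `TruncRankGE s C n` say that `C` has rank at least `n`
after truncating the matroid along the members of `s`, where the rank is given by the formula of
Rado. If `s` satisfies the Hall--Rado condition, then the condition for `F, G, s` only asks that `F`
and `G` have rank at least `1` and `F ⊔ G` rank at least `2` in the truncation along `s`, and
submodularity gives the relations.

Standard monomials span: two incomparable generators are straightened by the quadratic relation, and
`h_F h_G ^ d = h_G ^ (d + 1)` for `F ≤ G` and `d = rk G - rk F` (`gen_mul_gen_pow`) removes too large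
exponents. Each step keeps the degree and moves flats up in the lattice.

For independence and duality, each standard monomial `m` of degree `k` receives a test element
`∏ j, (h_{U j} - h_{V j})` of degree `r - k`, where the `U j` and `V j` run through the chain of `m`
completed by `⊤` and `⊥`. The indicator of a chain condition is a product of indicators, so the
degree of a monomial `m'` times the test element is again `0` or `1` (`degMap_mul_prod_sub`). It is
`1` for `m' = m`. In general it is `1` only if the flats of the chain of `m` have in the truncation
along `m'` the rank that they have in the truncation along `m`, and this forces the rank function of
the truncation along `m'` to be at most that of the truncation along `m`
(`IsStd.truncRankGE_of_truncRankGE`). As a standard monomial is determined by its truncation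
(`IsStd.eq_of_truncRankGE_iff`), the pairing of standard monomials with test elements is
unitriangular for the pointwise order of rank functions. Hence the standard monomials are
independent, and there are at most as many of them in degree `k` as in degree `r - k`; by symmetry
the numbers agree, and unitriangularity yields the perfect pairing (`bijective_degPairing`). Degree
`r` pairs with degree `0`, so `A^r` is infinite cyclic.
-/

noncomputable section

namespace LatticeMatroid

open Multiset (card)

/-! ### Rank in a finite lattice with submodular rank function -/

section Rank

variable {L : Type*} [Lattice L] [BoundedOrder L]

theorem height_lt_top_of_finite {L : Type*} [Lattice L] [Finite L] (F : L) :
    Order.height F < ⊤ := by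
  have := Fintype.ofFinite L
  refine lt_of_le_of_lt (Order.height_le (n := (Fintype.card L : ℕ∞)) fun p _ => ?_)
    (ENat.natCast_lt_top _)
  exact_mod_cast p.length_lt_card.le

theorem rk_strictMono (hM : IsMatroid L) : StrictMono (rk : L → ℕ) := by
  have := hM.finite
  intro F G hFG
  have hF := height_lt_top_of_finite F
  have hG := height_lt_top_of_finite G
  have h := Order.height_strictMono hFG hF
  rw [← ENat.natCast_toNat hF.ne, ← ENat.natCast_toNat hG.ne] at h
  exact_mod_cast h

theorem rk_mono (hM : IsMatroid L) : Monotone (rk : L → ℕ) := (rk_strictMono hM).monotone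

@[simp] theorem rk_bot : rk (⊥ : L) = 0 := by simp [rk]

theorem rk_pos (hM : IsMatroid L) {F : L} (hF : F ≠ ⊥) : 0 < rk F := by
  simpa using rk_strictMono hM (bot_lt_iff_ne_bot.2 hF)

theorem eq_of_le_of_rk_le (hM : IsMatroid L) {F G : L} (h : F ≤ G) (hr : rk G ≤ rk F) : F = G :=
  h.eq_of_not_lt fun hlt => absurd (rk_strictMono hM hlt) (not_lt.2 hr)

theorem rk_atom (hM : IsMatroid L) {a : L} (ha : IsAtom a) : rk a = 1 := by
  have := hM.finite
  refine le_antisymm ?_ (rk_pos hM ha.1)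
  have h1 : Order.height a ≤ 1 := by
    refine Order.height_le_coe_iff.2 fun b hb => ?_
    rw [ha.2 b hb]; simp
  simpa [rk] using ENat.toNat_le_toNat h1 (by simp)

theorem rk_sup_atom_le (hM : IsMatroid L) {a : L} (ha : IsAtom a) (F : L) :
    rk (F ⊔ a) ≤ rk F + 1 := by
  have := hM.submodular F a
  rw [rk_atom hM ha] at this
  omega

/-- Submodularity in the form: enlarging `A` to `B` raises the rank of the join with `C` by at most
`rk B - rk A`. -/
theorem rk_sup_sup_add_le (hM : IsMatroid L) {A B : L} (C : L) (h : A ≤ B) :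
    rk (C ⊔ B) + rk A ≤ rk (C ⊔ A) + rk B := by
  have h1 := hM.submodular (C ⊔ A) B
  have h2 : C ⊔ A ⊔ B = C ⊔ B := by rw [sup_assoc, sup_eq_right.2 h]
  have h3 : rk A ≤ rk ((C ⊔ A) ⊓ B) := rk_mono hM (le_inf le_sup_right h)
  rw [h2] at h1
  omega

theorem exists_atom_le_not_le (hM : IsMatroid L) {F G : L} (h : ¬ G ≤ F) :
    ∃ a, IsAtom a ∧ a ≤ G ∧ ¬ a ≤ F := by
  by_contra! hc
  exact h ((hM.atomic G).2 fun a ha => hc a ha.1 ha.2)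

end Rank

/-! ### Rank in a principal truncation -/

section Truncation

variable {L : Type*} [Lattice L] [BoundedOrder L]

/-- `TruncRankGE s C n` says that `C` has rank at least `n` in the matroid obtained from `L` by
truncating along every member of the multiset `s` of flats. Truncating along `F` imposes a generic
relation inside `F`, so the rank of `C` drops to the minimum over `t ≤ s` of
`rk (C ⊔ t.sup) - card t`, as in the theorem of Rado. -/
def TruncRankGE (s : Multiset L) (C : L) (n : ℕ) : Prop :=
  ∀ t ≤ s, card t + n ≤ rk (C ⊔ t.sup)

theorem le_cons_iff_exists {α : Type*} {a : α} {s t : Multiset α} :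
    t ≤ a ::ₘ s ↔ t ≤ s ∨ ∃ u ≤ s, t = a ::ₘ u := by
  classical
  constructor
  · intro h
    by_cases ha : a ∈ t
    · exact Or.inr ⟨t.erase a, Multiset.erase_le_iff_le_cons.2 h, (Multiset.cons_erase ha).symm⟩
    · exact Or.inl ((Multiset.le_cons_of_notMem ha).1 h)
  · rintro (h | ⟨u, hu, rfl⟩)
    · exact h.trans (Multiset.le_cons_self _ _)
    · exact Multiset.cons_le_cons _ hu

theorem exists_le_of_le_map {α β : Type*} {f : α → β} {s : Multiset α} {t : Multiset β}
    (h : t ≤ s.map f) : ∃ u ≤ s, u.map f = t := by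
  induction s using Multiset.induction_on generalizing t with
  | empty => exact ⟨0, le_rfl, (Multiset.le_zero.1 h).symm⟩
  | cons a s ih =>
    rw [Multiset.map_cons, le_cons_iff_exists] at h
    rcases h with h | ⟨u, hu, rfl⟩
    · obtain ⟨v, hv, rfl⟩ := ih h
      exact ⟨v, hv.trans (Multiset.le_cons_self _ _), rfl⟩
    · obtain ⟨v, hv, rfl⟩ := ih hu
      exact ⟨a ::ₘ v, Multiset.cons_le_cons _ hv, by simp⟩

theorem hallRado_iff {n : ℕ} (F : Fin n → NonemptyFlat L) :
    HallRado F ↔ TruncRankGE (Finset.univ.val.map fun i => (F i).1) ⊥ 0 := by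
  constructor
  · intro h t ht
    obtain ⟨u, hu, rfl⟩ := exists_le_of_le_map ht
    have := h ⟨u, Multiset.nodup_of_le hu Finset.univ.nodup⟩
    simpa [Finset.sup_def] using this
  · intro h T
    have := h (T.val.map fun i => (F i).1) (Multiset.map_le_map (Finset.val_le_iff.2 T.subset_univ))
    simpa [Finset.sup_def] using this

theorem truncRankGE_cons {a : L} {s : Multiset L} {C : L} {n : ℕ} :
    TruncRankGE (a ::ₘ s) C n ↔ TruncRankGE s C n ∧ TruncRankGE s (C ⊔ a) (n + 1) := by
  constructor
  · intro h
    refine ⟨fun t ht => h t (ht.trans (Multiset.le_cons_self _ _)), fun t ht => ?_⟩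
    have := h (a ::ₘ t) (Multiset.cons_le_cons _ ht)
    rw [Multiset.card_cons, Multiset.sup_cons, ← sup_assoc] at this
    omega
  · rintro ⟨h1, h2⟩ t ht
    rcases le_cons_iff_exists.1 ht with ht | ⟨u, hu, rfl⟩
    · exact h1 t ht
    · have := h2 u hu
      rw [Multiset.card_cons, Multiset.sup_cons, ← sup_assoc]
      omega

theorem TruncRankGE.mono (hM : IsMatroid L) {s : Multiset L} {C C' : L} {n n' : ℕ}
    (h : TruncRankGE s C n) (hC : C ≤ C') (hn : n' ≤ n) : TruncRankGE s C' n' := fun t ht =>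
  (Nat.add_le_add_left hn _).trans ((h t ht).trans (rk_mono hM (sup_le_sup_right hC _)))

theorem not_truncRankGE_bot {s : Multiset L} {n : ℕ} (hn : n ≠ 0) : ¬ TruncRankGE s ⊥ n := by
  intro h
  have := h 0 (Multiset.zero_le _)
  simp at this
  omega

/-- The join of two loops of a truncation is again a loop. -/
theorem TruncRankGE.one_sup (hM : IsMatroid L) {s : Multiset L} {F G : L}
    (h0 : TruncRankGE s ⊥ 0) (h : TruncRankGE s (F ⊔ G) 1) :
    TruncRankGE s F 1 ∨ TruncRankGE s G 1 := by
  classical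
  by_contra! hc
  obtain ⟨hF, hG⟩ := hc
  simp only [TruncRankGE, not_forall, not_le] at hF hG
  obtain ⟨t, ht, htr⟩ := hF
  obtain ⟨u, hu, hur⟩ := hG
  have h1 := h (t ∪ u) (Multiset.union_le ht hu)
  have h2 := h0 (t ∩ u) ((Multiset.inter_le_left).trans ht)
  have h3 := hM.submodular (F ⊔ t.sup) (G ⊔ u.sup)
  have h4 : rk (⊥ ⊔ (t ∩ u).sup) ≤ rk ((F ⊔ t.sup) ⊓ (G ⊔ u.sup)) := by
    refine rk_mono hM (sup_le bot_le (le_inf ?_ ?_))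
    · exact (Multiset.sup_mono (Multiset.subset_of_le Multiset.inter_le_left)).trans le_sup_right
    · exact (Multiset.sup_mono (Multiset.subset_of_le Multiset.inter_le_right)).trans le_sup_right
  have h5 : rk (F ⊔ G ⊔ (t ∪ u).sup) ≤ rk (F ⊔ t.sup ⊔ (G ⊔ u.sup)) := by
    refine rk_mono hM ?_
    rw [Multiset.sup_union]
    exact (sup_sup_sup_comm _ _ _ _).le
  have h6 : card (t ∪ u) + card (t ∩ u) = card t + card u := by
    rw [← Multiset.card_add, Multiset.union_add_inter, Multiset.card_add]
  omega

/-- Adjoining an atom raises the truncated rank by at most one. -/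
theorem TruncRankGE.of_sup_atom (hM : IsMatroid L) {s : Multiset L} {F a : L} (ha : IsAtom a)
    {n : ℕ} (h : TruncRankGE s (F ⊔ a) (n + 1)) : TruncRankGE s F n := by
  intro t ht
  have h1 := h t ht
  have h2 := rk_sup_atom_le hM ha (F ⊔ t.sup)
  rw [sup_right_comm] at h1
  omega

theorem not_truncRankGE_of_bot_mem (s : Multiset L) (hs : ⊥ ∈ s) (n : ℕ) :
    ¬ TruncRankGE s ⊥ n := by
  intro h
  have := h {⊥} (by simpa using hs)
  simp at this

/-- The quadratic relation `(h_F - h_{G ⊔ F}) (h_G - h_{G ⊔ F}) = 0`, read off on the Hall--Rado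
indicator: a truncation of `G ⊔ F` of rank at least two cannot have both `F` and `G` as loops. -/
theorem hallRado_quadratic (hM : IsMatroid L) (s : Multiset L) (F G : L) :
    (TruncRankGE (F ::ₘ G ::ₘ s) ⊥ 0 ↔ TruncRankGE (F ::ₘ (G ⊔ F) ::ₘ s) ⊥ 0 ∧
      TruncRankGE (G ::ₘ (G ⊔ F) ::ₘ s) ⊥ 0) ∧
    (TruncRankGE ((G ⊔ F) ::ₘ (G ⊔ F) ::ₘ s) ⊥ 0 ↔ TruncRankGE (F ::ₘ (G ⊔ F) ::ₘ s) ⊥ 0 ∨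
      TruncRankGE (G ::ₘ (G ⊔ F) ::ₘ s) ⊥ 0) := by
  simp only [truncRankGE_cons, bot_sup_eq, zero_add, one_add_one_eq_two, sup_comm F G,
    sup_idem, sup_left_idem, sup_right_idem, sup_comm F (G ⊔ F)]
  have h1 : TruncRankGE s F 1 → TruncRankGE s (G ⊔ F) 1 := fun h => h.mono hM le_sup_right le_rfl
  have h2 : TruncRankGE s (G ⊔ F) 2 → TruncRankGE s (G ⊔ F) 1 :=
    fun h => h.mono hM le_rfl one_le_two
  have h3 := fun h0 => TruncRankGE.one_sup hM (s := s) (F := G) (G := F) h0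
  tauto

theorem hallRado_atom_sq (hM : IsMatroid L) (s : Multiset L) {a : L} (ha : IsAtom a) :
    ¬ TruncRankGE (a ::ₘ a ::ₘ s) ⊥ 0 := by
  simp only [truncRankGE_cons, bot_sup_eq, zero_add, one_add_one_eq_two, sup_idem]
  rintro ⟨-, -, h⟩
  have := h 0 (Multiset.zero_le _)
  simp [rk_atom hM ha] at this

theorem hallRado_atom_mul (hM : IsMatroid L) (s : Multiset L) {a : L} (ha : IsAtom a) (F : L) :
    TruncRankGE (a ::ₘ F ::ₘ s) ⊥ 0 ↔ TruncRankGE (a ::ₘ (F ⊔ a) ::ₘ s) ⊥ 0 := by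
  simp only [truncRankGE_cons, bot_sup_eq, zero_add, one_add_one_eq_two, sup_comm a,
    sup_right_idem]
  have h1 : TruncRankGE s F 1 → TruncRankGE s (F ⊔ a) 1 := fun h => h.mono hM le_sup_left le_rfl
  have h2 : TruncRankGE s (F ⊔ a) 2 → TruncRankGE s F 1 := fun h => h.of_sup_atom hM ha
  tauto

/-- The Hall--Rado condition for a multiset enlarged by a chain `C 0 ≤ C 1 ≤ ⋯`: it suffices to
test initial segments of the chain. The bottom flat may stand in the chain at any place, since it
makes both sides fail. -/
theorem truncRankGE_add_chain (hM : IsMatroid L) (s : Multiset L) {n : ℕ} (C : Fin n → L)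
    (hC : ∀ i j, i < j → C i ≤ C j ∨ C j = ⊥) :
    TruncRankGE (s + Finset.univ.val.map C) ⊥ 0 ↔
      TruncRankGE s ⊥ 0 ∧ ∀ j, TruncRankGE s (C j) (j + 1) := by
  by_cases hbot : ∃ j, C j = ⊥
  · obtain ⟨j, hj⟩ := hbot
    refine iff_of_false (not_truncRankGE_of_bot_mem _ ?_ _) fun h => ?_
    · exact Multiset.mem_add.2 (Or.inr (Multiset.mem_map.2 ⟨j, Finset.mem_univ_val j, hj⟩))
    · have := h.2 j
      rw [hj] at this
      exact not_truncRankGE_bot (Nat.succ_ne_zero _) this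
  have hmono : ∀ i j, i < j → C i ≤ C j := fun i j hij =>
    (hC i j hij).resolve_right fun h => hbot ⟨j, h⟩
  -- Relative to an arbitrary flat `D`, so that the first member of the chain can be split off.
  have key : ∀ (n : ℕ) (C : Fin n → L), (∀ i j, i < j → C i ≤ C j) → ∀ (D : L) (k : ℕ),
      (TruncRankGE (s + Finset.univ.val.map C) D k ↔
        TruncRankGE s D k ∧ ∀ j, TruncRankGE s (D ⊔ C j) (k + j + 1)) := by
    intro n
    induction n with
    | zero => intro C _ D k; simp
    | succ n ih =>
      intro C hC D k
      have hcons : (Finset.univ : Finset (Fin (n + 1))).val.map C =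
          C 0 ::ₘ (Finset.univ : Finset (Fin n)).val.map fun i => C i.succ := by
        rw [Fin.univ_succ, Finset.cons_val, Multiset.map_cons, Finset.map_val, Multiset.map_map]
        rfl
      have hsucc : ∀ i j : Fin n, i < j → C i.succ ≤ C j.succ :=
        fun i j hij => hC _ _ (Fin.succ_lt_succ_iff.2 hij)
      rw [hcons, Multiset.add_cons, truncRankGE_cons, ih _ hsucc, ih _ hsucc, Fin.forall_fin_succ]
      have hsup : ∀ j : Fin n, D ⊔ C 0 ⊔ C j.succ = D ⊔ C j.succ := fun j => by
        rw [sup_assoc, sup_eq_right.2 (hC _ _ (Fin.succ_pos j))]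
      simp only [hsup, Fin.val_zero, Fin.val_succ, add_zero]
      constructor
      · rintro ⟨⟨h1, -⟩, h2, h3⟩
        exact ⟨h1, h2, fun j => (h3 j).mono hM le_rfl (by omega)⟩
      · rintro ⟨h1, h2, h3⟩
        exact ⟨⟨h1, fun j => (h3 j).mono hM le_rfl (by omega)⟩, h2,
          fun j => (h3 j).mono hM le_rfl (by omega)⟩
  simpa using key n C hmono ⊥ 0

end Truncation

/-! ### The generators indexed by all flats -/

section Generators

variable {L : Type*} [Lattice L] [BoundedOrder L]

open scoped Classical in
/-- The generator `h_F`, extended to all flats by `h_⊥ = 0`. All relations of the augmented Chow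
ring persist under this convention. -/
def gen (F : L) : AugChowRing L := if hF : F ≠ ⊥ then h ⟨F, hF⟩ else 0

@[simp] theorem gen_bot : gen (⊥ : L) = 0 := by simp [gen]

theorem gen_coe (F : NonemptyFlat L) : gen F.1 = h F := by simp [gen, F.2]

theorem gen_quadratic (F G : L) : (gen F - gen (G ⊔ F)) * (gen G - gen (G ⊔ F)) = 0 := by
  by_cases hF : F = ⊥
  · subst hF; simp
  by_cases hG : G = ⊥
  · subst hG; simp
  have hFG : G ⊔ F ≠ ⊥ := fun h => hG (sup_eq_bot_iff.1 h).1
  rw [gen, gen, gen, dif_pos hF, dif_pos hG, dif_pos hFG]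
  exact Ideal.Quotient.eq_zero_iff_mem.2
    (Ideal.subset_span (Or.inl (Or.inl ⟨⟨F, hF⟩, ⟨G, hG⟩, rfl⟩)))

theorem gen_atom_sq {a : L} (ha : IsAtom a) : gen a ^ 2 = 0 := by
  rw [gen, dif_pos ha.1]
  exact Ideal.Quotient.eq_zero_iff_mem.2
    (Ideal.subset_span (Or.inl (Or.inr ⟨⟨a, ha.1⟩, ha, rfl⟩)))

theorem gen_atom_mul {a : L} (ha : IsAtom a) (F : L) : gen a * gen F = gen a * gen (F ⊔ a) := by
  by_cases hF : F = ⊥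
  · subst hF
    rw [gen_bot, mul_zero, bot_sup_eq, ← sq, gen_atom_sq ha]
  have hFa : F ⊔ a ≠ ⊥ := fun h => hF (sup_eq_bot_iff.1 h).1
  rw [gen, gen, gen, dif_pos ha.1, dif_pos hF, dif_pos hFa, ← sub_eq_zero]
  exact Ideal.Quotient.eq_zero_iff_mem.2
    (Ideal.subset_span (Or.inr ⟨⟨a, ha.1⟩, ⟨F, hF⟩, ha, rfl⟩))

/-- The straightening relation for a chain. It follows from the case of a cover `F ⋖ F ⊔ a`, where
the quadratic relation for `F` and `a` reads `h_F h_{F ⊔ a} = h_{F ⊔ a} ^ 2`. -/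
theorem gen_mul_gen_pow (hM : IsMatroid L) {F G : L} (hFG : F ≤ G) :
    gen F * gen G ^ (rk G - rk F) = gen G ^ (rk G - rk F + 1) := by
  obtain ⟨d, hd⟩ : ∃ d, d = rk G - rk F := ⟨_, rfl⟩
  rw [← hd]
  induction d generalizing F with
  | zero =>
    rw [eq_of_le_of_rk_le hM hFG (Nat.sub_eq_zero_iff_le.1 hd.symm)]
    simp
  | succ d ih =>
    have hlt : ¬ G ≤ F := fun h => by
      have := rk_mono hM h
      omega
    obtain ⟨a, ha, haG, haF⟩ := exists_atom_le_not_le hM hlt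
    have hle : F ⊔ a ≤ G := sup_le hFG haG
    have h1 := rk_strictMono hM (left_lt_sup.2 haF)
    have h2 := rk_sup_atom_le hM ha F
    have hcover : gen F * gen (F ⊔ a) = gen (F ⊔ a) ^ 2 := by
      have h3 := gen_quadratic a F
      have h4 := gen_atom_mul ha F
      linear_combination -h3 + h4
    have h5 := ih hle (by omega)
    linear_combination gen G ^ d * hcover + (gen (F ⊔ a) + gen G - gen F) * h5

theorem gen_pow_eq_zero (hM : IsMatroid L) (F : L) {n : ℕ} (hn : rk F < n) : gen F ^ n = 0 := by
  have := gen_mul_gen_pow hM (bot_le : ⊥ ≤ F)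
  rw [gen_bot, zero_mul, rk_bot, Nat.sub_zero] at this
  exact pow_eq_zero_of_le hn this.symm

/-- The multiset of flats of a monomial. -/
def flats (m : NonemptyFlat L →₀ ℕ) : Multiset L := (Finsupp.toMultiset m).map Subtype.val

theorem flats_add (m n : NonemptyFlat L →₀ ℕ) : flats (m + n) = flats m + flats n := by
  simp [flats]

theorem flats_single (F : NonemptyFlat L) (a : ℕ) :
    flats (Finsupp.single F a) = Multiset.replicate a F.1 := by
  simp [flats, Finsupp.toMultiset_single, Multiset.nsmul_singleton]

theorem flats_add_single (m : NonemptyFlat L →₀ ℕ) (F : NonemptyFlat L) :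
    flats (m + Finsupp.single F 1) = F.1 ::ₘ flats m := by
  rw [flats_add, flats_single, Multiset.replicate_one, add_comm, Multiset.singleton_add]

theorem card_flats (m : NonemptyFlat L →₀ ℕ) : card (flats m) = m.degree := by
  simp [flats, Finsupp.card_toMultiset, Finsupp.degree_apply, Finsupp.sum]

theorem hMonomial_add (m n : NonemptyFlat L →₀ ℕ) :
    hMonomial (m + n) = hMonomial m * hMonomial n :=
  Finsupp.prod_add_index' (fun _ => pow_zero _) fun _ _ _ => pow_add _ _ _

theorem hMonomial_single (F : NonemptyFlat L) (a : ℕ) :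
    hMonomial (Finsupp.single F a) = gen F.1 ^ a := by
  rw [gen_coe]
  exact Finsupp.prod_single_index (pow_zero _)

theorem hMonomial_eq_prod_gen (m : NonemptyFlat L →₀ ℕ) :
    hMonomial m = ((flats m).map gen).prod := by
  induction m using Finsupp.induction_linear with
  | zero => simp [hMonomial, flats]
  | add m n hm hn => rw [hMonomial_add, flats_add, Multiset.map_add, Multiset.prod_add, hm, hn]
  | single F a => simp [hMonomial_single, flats_single]

theorem mk_monomial (m : NonemptyFlat L →₀ ℕ) :
    augChowMk L (MvPolynomial.monomial m 1) = hMonomial m := by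
  rw [MvPolynomial.monomial_eq, map_one, one_mul]
  exact (map_finsuppProd (Ideal.Quotient.mk (augChowIdeal L)) m _).trans
    (Finsupp.prod_congr fun F _ => map_pow _ _ _)

end Generators

/-! ### The degree functional -/

section Degree

variable {L : Type*} [Lattice L] [BoundedOrder L]

open scoped Classical in
/-- The expected degree of the product of a multiset of generators: the indicator of the
Hall--Rado condition, extended by zero to the degrees other than `r`. -/
def hrWeight (r : ℕ) (s : Multiset L) : ℤ := if card s = r ∧ TruncRankGE s ⊥ 0 then 1 else 0

/-- The functional on polynomials that takes a monomial to its expected degree. -/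
def polyDeg (L : Type*) [Lattice L] [BoundedOrder L] (r : ℕ) :
    MvPolynomial (NonemptyFlat L) ℤ →ₗ[ℤ] ℤ :=
  (MvPolynomial.basisMonomials (NonemptyFlat L) ℤ).constr ℤ fun m => hrWeight r (flats m)

theorem polyDeg_monomial (r : ℕ) (m : NonemptyFlat L →₀ ℕ) :
    polyDeg L r (MvPolynomial.monomial m 1) = hrWeight r (flats m) := by
  exact (MvPolynomial.basisMonomials (NonemptyFlat L) ℤ).constr_basis ℤ _ m

theorem polyDeg_monomial_mul (r : ℕ) (m : NonemptyFlat L →₀ ℕ) (F G : NonemptyFlat L) :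
    polyDeg L r (MvPolynomial.monomial m 1 * (MvPolynomial.X F * MvPolynomial.X G)) =
      hrWeight r (F.1 ::ₘ G.1 ::ₘ flats m) := by
  rw [mul_left_comm, MvPolynomial.X, MvPolynomial.X, MvPolynomial.monomial_mul,
    MvPolynomial.monomial_mul, one_mul, one_mul, polyDeg_monomial, add_comm, flats_add_single,
    flats_add_single]

theorem hrWeight_quadratic (hM : IsMatroid L) (r : ℕ) (s : Multiset L) (F G : L) :
    hrWeight r (F ::ₘ G ::ₘ s) - hrWeight r (F ::ₘ (G ⊔ F) ::ₘ s) -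
      hrWeight r (G ::ₘ (G ⊔ F) ::ₘ s) + hrWeight r ((G ⊔ F) ::ₘ (G ⊔ F) ::ₘ s) = 0 := by
  classical
  obtain ⟨h1, h2⟩ := hallRado_quadratic hM s F G
  have e : ∀ (t : Multiset L) (P : Prop), card t = card s + 2 → (TruncRankGE t ⊥ 0 ↔ P) →
      hrWeight r t = if card s + 2 = r ∧ P then 1 else 0 := fun t P ht hP =>
    if_congr (and_congr (by rw [ht]) hP) rfl rfl
  rw [e _ _ (by simp) h1, e _ _ (by simp) h2, e (F ::ₘ (G ⊔ F) ::ₘ s) _ (by simp) Iff.rfl,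
    e (G ::ₘ (G ⊔ F) ::ₘ s) _ (by simp) Iff.rfl]
  split_ifs <;> first | rfl | (exfalso; tauto)

theorem polyDeg_eq_zero (hM : IsMatroid L) (r : ℕ) {p : MvPolynomial (NonemptyFlat L) ℤ}
    (hp : p ∈ augChowIdeal L) : polyDeg L r p = 0 := by
  suffices ∀ q, polyDeg L r (q * p) = 0 by simpa using this 1
  induction hp using Submodule.span_induction with
  | zero => simp
  | add p q _ _ hp hq => intro a; rw [mul_add, map_add, hp, hq, add_zero]
  | smul a p _ hp => intro q; rw [smul_eq_mul, ← mul_assoc]; exact hp _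
  | mem g hg =>
    suffices polyDeg L r ∘ₗ LinearMap.mulRight ℤ g = 0 from fun q => DFunLike.congr_fun this q
    refine (MvPolynomial.basisMonomials (NonemptyFlat L) ℤ).ext fun m => ?_
    rw [MvPolynomial.coe_basisMonomials, LinearMap.comp_apply, LinearMap.mulRight_apply,
      LinearMap.zero_apply]
    rcases hg with (⟨F, G, rfl⟩ | ⟨a, ha, rfl⟩) | ⟨a, F, ha, rfl⟩
    · have hexp : (MvPolynomial.X F - MvPolynomial.X (G ⊔ F)) *
          (MvPolynomial.X G - MvPolynomial.X (G ⊔ F)) =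
          (MvPolynomial.X F * MvPolynomial.X G - MvPolynomial.X F * MvPolynomial.X (G ⊔ F) -
          MvPolynomial.X G * MvPolynomial.X (G ⊔ F) +
          MvPolynomial.X (G ⊔ F) * MvPolynomial.X (G ⊔ F) :
          MvPolynomial (NonemptyFlat L) ℤ) := by ring
      rw [hexp, mul_add, mul_sub, mul_sub, map_add, map_sub, map_sub]
      simp only [polyDeg_monomial_mul]
      exact hrWeight_quadratic hM r _ _ _
    · classical
      rw [sq, polyDeg_monomial_mul, hrWeight, if_neg fun h => hallRado_atom_sq hM _ ha h.2]
    · classical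
      rw [mul_sub, map_sub, polyDeg_monomial_mul, polyDeg_monomial_mul, sub_eq_zero]
      exact if_congr (and_congr (by simp) (hallRado_atom_mul hM (flats m) ha F.1)) rfl rfl

/-- The degree functional on the augmented Chow ring, zero outside of degree `r`. -/
def degMap (hM : IsMatroid L) (r : ℕ) : AugChowRing L →ₗ[ℤ] ℤ :=
  (QuotientAddGroup.lift (augChowIdeal L).toAddSubgroup (polyDeg L r).toAddMonoidHom
    fun _ hp => polyDeg_eq_zero hM r hp).toIntLinearMap

theorem degMap_mk (hM : IsMatroid L) (r : ℕ) (p : MvPolynomial (NonemptyFlat L) ℤ) :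
    degMap hM r (augChowMk L p) = polyDeg L r p := rfl

theorem degMap_prod_gen (hM : IsMatroid L) (r : ℕ) (s : Multiset L) :
    degMap hM r (s.map gen).prod = hrWeight r s := by
  by_cases hs : ⊥ ∈ s
  · rw [Multiset.prod_eq_zero (Multiset.mem_map.2 ⟨⊥, hs, gen_bot⟩), map_zero, hrWeight,
      if_neg fun h => not_truncRankGE_of_bot_mem s hs 0 h.2]
  · obtain ⟨m, rfl⟩ : ∃ m : NonemptyFlat L →₀ ℕ, flats m = s := by
      lift s to Multiset (NonemptyFlat L) using fun F hF h => hs (h ▸ hF)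
      classical
      exact ⟨Multiset.toFinsupp s, by simp [flats]⟩
    rw [← hMonomial_eq_prod_gen, ← mk_monomial, degMap_mk, polyDeg_monomial]

end Degree

/-! ### Standard monomials -/

section Standard

open scoped Classical

variable {L : Type*} [Lattice L] [BoundedOrder L]

/-- The number of members of the multiset `s` that lie below `F`. -/
def below (s : Multiset L) (F : L) : ℕ := s.countP (· ≤ F)

/-- Standardness in terms of the multiset of flats of a monomial. Here `rk F - below s F` is the
rank of `F` in the truncation along `s`. It increases strictly along the chain of the members of
`s`, completed by the greatest flat. -/
structure IsStd (s : Multiset L) : Prop where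
  chain : ∀ F ∈ s, ∀ G ∈ s, F ≤ G ∨ G ≤ F
  below_le : ∀ F ∈ ⊤ ::ₘ s, below s F ≤ rk F
  strict : ∀ F ∈ s, ∀ G ∈ ⊤ ::ₘ s, F < G → rk F + below s G < rk G + below s F

@[simp] theorem below_top (s : Multiset L) : below s ⊤ = card s :=
  Multiset.countP_eq_card.2 fun _ _ => le_top

theorem below_mono {L : Type*} [Lattice L] (s : Multiset L) {F G : L} (h : F ≤ G) :
    below s F ≤ below s G := by
  rw [below, below, Multiset.countP_eq_card_filter, Multiset.countP_eq_card_filter]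
  exact Multiset.card_le_card (Multiset.monotone_filter_right _ fun _ hx => hx.trans h)

theorem card_le_below {s t : Multiset L} (hts : t ≤ s) {F : L} (h : t.sup ≤ F) :
    card t ≤ below s F :=
  (Multiset.countP_eq_card.2 fun _ hx => (Multiset.le_sup hx).trans h).ge.trans
    (Multiset.countP_le_of_le _ hts)

theorem exists_le_sup_le_card_eq_below (s : Multiset L) (F : L) :
    ∃ t ≤ s, t.sup ≤ F ∧ card t = below s F := by
  exact ⟨s.filter (· ≤ F), Multiset.filter_le _ _,
    Multiset.sup_le.2 fun x hx => (Multiset.mem_filter.1 hx).2,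
    (Multiset.countP_eq_card_filter _ _).symm⟩

theorem flats_sum_single {n : ℕ} (F : Fin n → NonemptyFlat L) (a : Fin n → ℕ) :
    flats (∑ i, Finsupp.single (F i) (a i)) = ∑ i, Multiset.replicate (a i) (F i).1 := by
  have : ∀ s : Finset (Fin n), flats (∑ i ∈ s, Finsupp.single (F i) (a i)) =
      ∑ i ∈ s, Multiset.replicate (a i) (F i).1 := by
    intro s
    induction s using Finset.cons_induction with
    | empty => simp [flats]
    | cons i s hi ih => rw [Finset.sum_cons, Finset.sum_cons, flats_add, flats_single, ih]
  exact this _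

theorem below_sum_replicate {n : ℕ} {F : Fin n → NonemptyFlat L} (hF : StrictMono F)
    (a : Fin n → ℕ) (j : Fin n) :
    below (∑ i, Multiset.replicate (a i) (F i).1) (F j).1 = ∑ i ∈ Finset.Iic j, a i := by
  have h1 : ∀ s : Finset (Fin n), below (∑ i ∈ s, Multiset.replicate (a i) (F i).1) (F j).1 =
      ∑ i ∈ s, if i ≤ j then a i else 0 := by
    intro s
    induction s using Finset.cons_induction with
    | empty => simp [below]
    | cons i s hi ih =>
      rw [Finset.sum_cons, Finset.sum_cons, ← ih, below, Multiset.countP_add, below,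
        Multiset.countP_eq_card_filter]
      congr 1
      have : (F i).1 ≤ (F j).1 ↔ i ≤ j := hF.le_iff_le
      split_ifs with hij
      · rw [Multiset.filter_eq_self.2 fun x hx => by
          rw [(Multiset.mem_replicate.1 hx).2]; exact this.2 hij, Multiset.card_replicate]
      · rw [Multiset.filter_eq_nil.2 fun x hx => by
          rw [(Multiset.mem_replicate.1 hx).2]; exact fun h => hij (this.1 h), Multiset.card_zero]
  rw [h1, ← Finset.sum_filter]
  congr 1
  ext; simp

theorem mem_sum_replicate {n : ℕ} {F : Fin n → NonemptyFlat L} {a : Fin n → ℕ} {G : L}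
    (hG : G ∈ ∑ i, Multiset.replicate (a i) (F i).1) : ∃ i, G = (F i).1 := by
  obtain ⟨i, -, hi⟩ := Multiset.mem_sum.1 hG
  exact ⟨i, (Multiset.mem_replicate.1 hi).2⟩

theorem IsStandard.isStd (hM : IsMatroid L) {m : NonemptyFlat L →₀ ℕ} (hm : IsStandard m) :
    IsStd (flats m) := by
  obtain ⟨n, F, a, hF, -, hfirst, hnext, rfl⟩ := hm
  rw [flats_sum_single]
  set s : Multiset L := ∑ i, Multiset.replicate (a i) (F i).1 with hs
  have hchain : ∀ A ∈ s, ∀ B ∈ s, A ≤ B ∨ B ≤ A := by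
    intro A hA B hB
    obtain ⟨i, rfl⟩ := mem_sum_replicate hA
    obtain ⟨j, rfl⟩ := mem_sum_replicate hB
    exact (le_total i j).imp (fun h => hF.monotone h) fun h => hF.monotone h
  rcases n with _ | n
  · have hs0 : s = 0 := by simp [hs]
    rw [hs0]
    exact ⟨by simp, by simp [below], by simp⟩
  have hbelow : ∀ j, below s (F j).1 = ∑ i ∈ Finset.Iic j, a i := below_sum_replicate hF a
  have hg : StrictMono fun i => (rk (F i).1 : ℤ) - below s (F i).1 := by
    refine Fin.strictMono_iff_lt_succ.2 fun i => ?_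
    have h1 := hnext i.succ i.castSucc (by simp)
    have h2 : Finset.Iic i.succ = insert i.succ (Finset.Iic i.castSucc) := by
      ext j
      simp only [Finset.mem_Iic, Finset.mem_insert, Fin.le_def, Fin.ext_iff, Fin.val_succ,
        Fin.val_castSucc]
      omega
    have h3 : below s (F i.succ).1 = a i.succ + below s (F i.castSucc).1 := by
      rw [hbelow, hbelow, h2, Finset.sum_insert (by simp [Fin.le_def])]
    omega
  have hlast : below s (F (Fin.last n)).1 = card s := by
    refine Multiset.countP_eq_card.2 fun A hA => ?_
    obtain ⟨i, rfl⟩ := mem_sum_replicate hA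
    exact hF.monotone (Fin.le_last i)
  have hpos : ∀ i, below s (F i).1 ≤ rk (F i).1 := by
    intro i
    have h0 : below s (F 0).1 ≤ rk (F 0).1 := by
      rw [hbelow]
      refine le_trans (le_of_eq ?_) (hfirst 0 rfl)
      rw [show Finset.Iic (0 : Fin (n + 1)) = {0} by ext; simp, Finset.sum_singleton]
    have := hg.monotone (Fin.zero_le i)
    omega
  have hlasttop := rk_mono hM (le_top : (F (Fin.last n)).1 ≤ ⊤)
  refine ⟨hchain, fun A hA => ?_, fun A hA B hB hAB => ?_⟩
  · rcases Multiset.mem_cons.1 hA with rfl | hA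
    · rw [below_top, ← hlast]
      exact (hpos _).trans hlasttop
    · obtain ⟨i, rfl⟩ := mem_sum_replicate hA
      exact hpos i
  · obtain ⟨i, rfl⟩ := mem_sum_replicate hA
    rcases Multiset.mem_cons.1 hB with rfl | hB
    · rw [below_top, ← hlast]
      -- The last flat of the chain may be `⊤` itself, but then `i` is not the last index.
      rcases (Fin.le_last i).eq_or_lt with rfl | hi
      · have := rk_strictMono hM hAB
        omega
      · have := hg hi
        simp only at this
        omega
    · obtain ⟨j, rfl⟩ := mem_sum_replicate hB
      have := hg (hF.lt_iff_lt.1 (show F i < F j from hAB))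
      simp only at this
      omega

/-- The bound on the exponents need only be checked in this form, where `m F ≤ rk F` is asked of all
flats and the other bound of all pairs, since these are what straightening enforces. -/
theorem isStandard_of_chain {m : NonemptyFlat L →₀ ℕ}
    (hchain : ∀ F ∈ m.support, ∀ G ∈ m.support, F ≤ G ∨ G ≤ F)
    (hle : ∀ F ∈ m.support, m F ≤ rk F.1)
    (hlt : ∀ F ∈ m.support, ∀ G ∈ m.support, F < G → rk F.1 + m G < rk G.1) : IsStandard m := by
  let _ : LinearOrder {F // F ∈ m.support} :=
    { (inferInstance : PartialOrder {F // F ∈ m.support}) with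
      le_total := fun F G => hchain F.1 F.2 G.1 G.2
      toDecidableLE := Classical.decRel _ }
  let e := monoEquivOfFin {F // F ∈ m.support} rfl
  refine ⟨_, fun i => (e i).1, fun i => m (e i).1, fun i j hij => e.strictMono hij,
    fun i => Nat.pos_of_ne_zero (Finsupp.mem_support_iff.1 (e i).2),
    fun i _ => hle _ (e i).2, fun i j hij => ?_, ?_⟩
  · have hji : j < i := Fin.lt_def.2 (by omega)
    have := hlt _ (e j).2 _ (e i).2 (e.strictMono hji)
    push_cast
    omega
  · conv_lhs => rw [← Finsupp.sum_single m]
    rw [Finsupp.sum, ← Finset.sum_coe_sort]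
    exact (Equiv.sum_comp e.toEquiv fun F : {F // F ∈ m.support} => Finsupp.single F.1 (m F.1)).symm

end Standard

/-! ### Straightening -/

section Straightening

variable {L : Type*} [Lattice L] [BoundedOrder L]

/-- The span of the standard monomials of degree `k`. -/
def stdSpan (L : Type*) [Lattice L] [BoundedOrder L] (k : ℕ) : Submodule ℤ (AugChowRing L) :=
  Submodule.span ℤ (hMonomial '' {m | IsStandard m ∧ m.degree = k})

/-- The total corank of the flats of a monomial, which drops under straightening. -/
def defect (m : NonemptyFlat L →₀ ℕ) : ℕ := ((flats m).map fun F => rk (⊤ : L) - rk F).sum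

theorem defect_add (m n : NonemptyFlat L →₀ ℕ) : defect (m + n) = defect m + defect n := by
  simp [defect, flats_add]

theorem defect_single (F : NonemptyFlat L) (a : ℕ) :
    defect (Finsupp.single F a) = a * (rk (⊤ : L) - rk F.1) := by
  simp [defect, flats_single]

theorem single_add_single_le {m : NonemptyFlat L →₀ ℕ} {F G : NonemptyFlat L} (hFG : F ≠ G)
    {a b : ℕ} (hF : a ≤ m F) (hG : b ≤ m G) :
    Finsupp.single F a + Finsupp.single G b ≤ m := by
  classical
  intro K
  rw [Finsupp.add_apply, Finsupp.single_apply, Finsupp.single_apply]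
  split_ifs with h1 h2 h2
  · exact absurd (h1.trans h2.symm) hFG
  · subst h1; omega
  · subst h2; omega
  · omega

/-- Straightening: a monomial that is not standard vanishes or is a combination of monomials of the
same degree with smaller defect. -/
theorem hMonomial_mem_stdSpan (hM : IsMatroid L) (m : NonemptyFlat L →₀ ℕ) :
    hMonomial m ∈ stdSpan L m.degree := by
  induction hN : defect m using Nat.strong_induction_on generalizing m with
  | _ N ih =>
  subst hN
  have hcorank : ∀ {F G : NonemptyFlat L}, F < G →
      rk (⊤ : L) - rk G.1 < rk (⊤ : L) - rk F.1 := fun {F G} h => by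
    have h1 := rk_strictMono hM (show F.1 < G.1 from h)
    have h2 := rk_mono hM (le_top : G.1 ≤ ⊤)
    omega
  have step : ∀ m' : NonemptyFlat L →₀ ℕ, m'.degree = m.degree → defect m' < defect m →
      hMonomial m' ∈ stdSpan L m.degree := fun m' hd hlt => hd ▸ ih _ hlt m' rfl
  by_cases hchain : ∀ F ∈ m.support, ∀ G ∈ m.support, F ≤ G ∨ G ≤ F
  swap
  · push Not at hchain
    obtain ⟨F, hF, G, hG, hFG, hGF⟩ := hchain
    have hle : Finsupp.single F 1 + Finsupp.single G 1 ≤ m :=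
      single_add_single_le (fun h => hFG h.le)
        (Nat.one_le_iff_ne_zero.2 (Finsupp.mem_support_iff.1 hF))
        (Nat.one_le_iff_ne_zero.2 (Finsupp.mem_support_iff.1 hG))
    obtain ⟨n, rfl⟩ := exists_add_of_le hle
    have hFK := hcorank (lt_of_le_of_ne (show F ≤ G ⊔ F from le_sup_right (α := L))
      fun h => hGF (h ▸ (le_sup_left (α := L) : G.1 ≤ G.1 ⊔ F.1)))
    have hGK := hcorank (lt_of_le_of_ne (show G ≤ G ⊔ F from le_sup_left (α := L))
      fun h => hFG (h ▸ (le_sup_right (α := L) : F.1 ≤ G.1 ⊔ F.1)))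
    have hrel : hMonomial (Finsupp.single F 1 + Finsupp.single G 1 + n) =
        hMonomial (Finsupp.single F 1 + Finsupp.single (G ⊔ F) 1 + n) +
        hMonomial (Finsupp.single G 1 + Finsupp.single (G ⊔ F) 1 + n) -
        hMonomial (Finsupp.single (G ⊔ F) 1 + Finsupp.single (G ⊔ F) 1 + n) := by
      simp only [hMonomial_add, hMonomial_single, pow_one]
      linear_combination hMonomial n * gen_quadratic F.1 G.1
    rw [hrel]
    refine sub_mem (add_mem (step _ ?_ ?_) (step _ ?_ ?_)) (step _ ?_ ?_)
    all_goals simp only [map_add, Finsupp.degree_single, defect_add, defect_single]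
    all_goals omega
  by_cases hle : ∀ F ∈ m.support, m F ≤ rk F.1
  swap
  · push Not at hle
    obtain ⟨F, -, hF⟩ := hle
    have : Finsupp.single F (m F) ≤ m := Finsupp.single_le_iff.2 le_rfl
    obtain ⟨n, hn⟩ := exists_add_of_le this
    rw [show hMonomial m = 0 by
      rw [hn, hMonomial_add, hMonomial_single, gen_pow_eq_zero hM _ hF, zero_mul]]
    exact zero_mem _
  by_cases hlt : ∀ F ∈ m.support, ∀ G ∈ m.support, F < G → rk F.1 + m G < rk G.1
  swap
  · push Not at hlt
    obtain ⟨F, hF, G, hG, hFG, hr⟩ := hlt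
    have hle : Finsupp.single F 1 + Finsupp.single G (rk G.1 - rk F.1) ≤ m :=
      single_add_single_le hFG.ne (Nat.one_le_iff_ne_zero.2 (Finsupp.mem_support_iff.1 hF))
        (by omega)
    obtain ⟨n, rfl⟩ := exists_add_of_le hle
    have hrel : hMonomial (Finsupp.single F 1 + Finsupp.single G (rk G.1 - rk F.1) + n) =
        hMonomial (Finsupp.single G (rk G.1 - rk F.1 + 1) + n) := by
      simp only [hMonomial_add, hMonomial_single, pow_one, gen_mul_gen_pow hM hFG.le]
    rw [hrel]
    have := hcorank hFG
    refine step _ ?_ ?_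
    all_goals simp only [map_add, Finsupp.degree_single, defect_add, defect_single, add_mul]
    all_goals omega
  exact Submodule.subset_span ⟨m, ⟨isStandard_of_chain hchain hle hlt, rfl⟩, rfl⟩

theorem hMonomial_mem_augChowGrade (m : NonemptyFlat L →₀ ℕ) :
    hMonomial m ∈ augChowGrade L m.degree :=
  ⟨MvPolynomial.monomial m 1, MvPolynomial.isHomogeneous_monomial _ rfl, mk_monomial m⟩

theorem augChowGrade_eq_stdSpan (hM : IsMatroid L) (k : ℕ) : augChowGrade L k = stdSpan L k := by
  apply le_antisymm
  · rintro _ ⟨p, hp, rfl⟩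
    rw [← p.support_sum_monomial_coeff, map_sum]
    refine Submodule.sum_mem _ fun m hm => ?_
    rw [← mul_one (p.coeff m), ← smul_eq_mul, ← MvPolynomial.smul_monomial, map_smul, mk_monomial]
    have hdeg : m.degree = k := by
      by_contra h
      exact MvPolynomial.mem_support_iff.1 hm (MvPolynomial.IsHomogeneous.coeff_eq_zero hp h)
    exact Submodule.smul_mem _ _ (hdeg ▸ hMonomial_mem_stdSpan hM m)
  · refine Submodule.span_le.2 ?_
    rintro _ ⟨m, ⟨-, rfl⟩, rfl⟩
    exact hMonomial_mem_augChowGrade m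

theorem span_standard_eq_top (hM : IsMatroid L) :
    Submodule.span ℤ (hMonomial '' {m : NonemptyFlat L →₀ ℕ | IsStandard m}) = ⊤ := by
  refine eq_top_iff.2 fun x _ => ?_
  obtain ⟨p, rfl⟩ := Ideal.Quotient.mk_surjective x
  change augChowMk L p ∈ _
  rw [← p.support_sum_monomial_coeff, map_sum]
  refine Submodule.sum_mem _ fun m _ => ?_
  rw [← mul_one (p.coeff m), ← smul_eq_mul, ← MvPolynomial.smul_monomial, map_smul, mk_monomial]
  refine Submodule.smul_mem _ _ (Submodule.span_mono ?_ (hMonomial_mem_stdSpan hM m))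
  exact Set.image_mono fun _ h => h.1

end Straightening

/-! ### Test elements for standard monomials -/

section Test

open scoped Classical

variable {L : Type*} [Lattice L] [BoundedOrder L]

theorem sup_mem_of_chain {t : Multiset L} (ht : t ≠ 0)
    (hchain : ∀ F ∈ t, ∀ G ∈ t, F ≤ G ∨ G ≤ F) : t.sup ∈ t := by
  induction t using Multiset.induction_on with
  | empty => exact absurd rfl ht
  | cons F t ih =>
    rw [Multiset.sup_cons]
    by_cases h0 : t = 0
    · simp [h0]
    have hmem := ih h0 fun A hA B hB =>
      hchain A (Multiset.mem_cons_of_mem hA) B (Multiset.mem_cons_of_mem hB)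
    rcases hchain F (Multiset.mem_cons_self _ _) _ (Multiset.mem_cons_of_mem hmem) with h | h
    · rw [sup_eq_right.2 h]
      exact Multiset.mem_cons_of_mem hmem
    · rw [sup_eq_left.2 h]
      exact Multiset.mem_cons_self _ _

theorem IsStd.chain_cons_top {s : Multiset L} (hs : IsStd s) :
    ∀ F ∈ ⊤ ::ₘ s, ∀ G ∈ ⊤ ::ₘ s, F ≤ G ∨ G ≤ F := by
  intro F hF G hG
  rcases Multiset.mem_cons.1 hF with rfl | hF
  · exact Or.inr le_top
  rcases Multiset.mem_cons.1 hG with rfl | hG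
  · exact Or.inl le_top
  exact hs.chain F hF G hG

theorem IsStd.sup_mem {s t : Multiset L} (hs : IsStd s) (hts : t ≤ s) (ht : t ≠ 0) : t.sup ∈ s :=
  Multiset.mem_of_le hts (sup_mem_of_chain ht fun F hF G hG =>
    hs.chain F (Multiset.mem_of_le hts hF) G (Multiset.mem_of_le hts hG))

theorem IsStd.hallRado {s : Multiset L} (hs : IsStd s) : TruncRankGE s ⊥ 0 := by
  intro t hts
  by_cases ht : t = 0
  · simp [ht]
  have h1 := hs.below_le t.sup (Multiset.mem_cons_of_mem (hs.sup_mem hts ht))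
  have h2 := card_le_below hts (le_refl t.sup)
  rw [bot_sup_eq]
  omega

/-- A flat above a member `F` of a standard multiset has truncated rank at least
`rk F - below s F`, and more if it differs from `F`: the members of `s` remain flats in the
truncation along `s`. -/
theorem IsStd.le_rk_sup (hM : IsMatroid L) {s : Multiset L} (hs : IsStd s) {F C : L}
    (hF : F ∈ ⊤ ::ₘ s) (hFC : F ≤ C) {t : Multiset L} (hts : t ≤ s) :
    rk F + card t ≤ rk (C ⊔ t.sup) + below s F ∧
      (F ∈ s → F < C → rk F + card t < rk (C ⊔ t.sup) + below s F) := by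
  by_cases htF : t.sup ≤ F
  · have h1 := card_le_below hts htF
    have h2 := rk_mono hM (hFC.trans (le_sup_left : C ≤ C ⊔ t.sup))
    refine ⟨by omega, fun _ hlt => ?_⟩
    have h3 := rk_strictMono hM (hlt.trans_le (le_sup_left : C ≤ C ⊔ t.sup))
    omega
  · have ht : t ≠ 0 := by rintro rfl; simp at htF
    have hmem := hs.sup_mem hts ht
    have hlt : F < t.sup := lt_of_le_not_ge
      ((hs.chain_cons_top F hF _ (Multiset.mem_cons_of_mem hmem)).resolve_right htF) htF
    have hFs : F ∈ s := (Multiset.mem_cons.1 hF).resolve_left (ne_top_of_lt hlt)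
    have h1 := hs.strict F hFs _ (Multiset.mem_cons_of_mem hmem) hlt
    have h2 := card_le_below hts (le_refl t.sup)
    have h3 := rk_mono hM (le_sup_right : t.sup ≤ C ⊔ t.sup)
    omega

theorem IsStd.truncRankGE (hM : IsMatroid L) {s : Multiset L} (hs : IsStd s) {F : L}
    (hF : F ∈ ⊤ ::ₘ s) {n : ℕ} (hn : n + below s F ≤ rk F) : TruncRankGE s F n := by
  intro t hts
  have := (hs.le_rk_sup hM hF le_rfl hts).1
  omega

theorem not_truncRankGE_of_lt {s : Multiset L} {F : L} {n : ℕ} (hn : rk F < n + below s F) :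
    ¬ TruncRankGE s F n := by
  intro h
  obtain ⟨t, hts, htF, ht⟩ := exists_le_sup_le_card_eq_below s F
  have := h t hts
  rw [sup_eq_left.2 htF] at this
  omega

theorem prod_sdiff_mul_prod_eq_prod {ι R : Type*} [Fintype ι] [DecidableEq ι] [CommMonoid R]
    (T : Finset ι) (f g c : ι → R) (hc : ∀ j, c j = if j ∈ T then g j else f j) :
    (∏ j ∈ Finset.univ \ T, f j) * ∏ j ∈ T, g j = ∏ j, c j := by
  rw [← Finset.prod_sdiff (Finset.subset_univ T)]
  congr 1
  · exact Finset.prod_congr rfl fun j hj => by rw [hc, if_neg (Finset.mem_sdiff.1 hj).2]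
  · exact Finset.prod_congr rfl fun j hj => by rw [hc, if_pos hj]

/-- The degree of a monomial times a product of differences `h_{U j} - h_{V j}` along a chain: it
counts whether, in the truncation along `s`, each `U j` has rank greater than `j` while `V j` has
rank at most `j`. -/
theorem degMap_mul_prod_sub (hM : IsMatroid L) (r : ℕ) (s : Multiset L) {n : ℕ} {U V : Fin n → L}
    (hUU : ∀ i j, i < j → U i ≤ U j) (hUV : ∀ i j, i < j → U i ≤ V j ∨ V j = ⊥)
    (hVU : ∀ j, V j ≤ U j) :
    degMap hM r ((s.map gen).prod * ∏ j, (gen (U j) - gen (V j))) =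
      if card s + n = r ∧ TruncRankGE s ⊥ 0 ∧
        ∀ j : Fin n, TruncRankGE s (U j) (j + 1) ∧ ¬ TruncRankGE s (V j) (j + 1) then 1 else 0 := by
  let u : Fin n → ℤ := fun j => if TruncRankGE s (U j) (j + 1) then 1 else 0
  let v : Fin n → ℤ := fun j => if TruncRankGE s (V j) (j + 1) then 1 else 0
  -- Choosing `V j` for `j ∈ T` and `U j` otherwise gives a chain, possibly interrupted by `⊥`.
  have hterm : ∀ T : Finset (Fin n), degMap hM r ((s.map gen).prod *
      ((∏ j ∈ Finset.univ \ T, gen (U j)) * ∏ j ∈ T, gen (V j))) =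
      (if card s + n = r ∧ TruncRankGE s ⊥ 0 then 1 else 0) *
        ((∏ j ∈ Finset.univ \ T, u j) * ∏ j ∈ T, v j) := by
    intro T
    let C : Fin n → L := fun j => if j ∈ T then V j else U j
    have hC : ∀ i j, i < j → C i ≤ C j ∨ C j = ⊥ := by
      intro i j hij
      have hi : C i ≤ U i := by
        by_cases h : i ∈ T
        · simpa [C, h] using hVU i
        · simp [C, h]
      by_cases h : j ∈ T
      · simpa [C, h] using (hUV i j hij).imp_left hi.trans
      · simpa [C, h] using Or.inl (hi.trans (hUU i j hij))
    rw [prod_sdiff_mul_prod_eq_prod T (fun j => gen (U j)) (fun j => gen (V j))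
        (fun j => gen (C j)) fun j => by by_cases h : j ∈ T <;> simp [C, h],
      prod_sdiff_mul_prod_eq_prod T u v (fun j => if TruncRankGE s (C j) (j + 1) then 1 else 0)
        fun j => by by_cases h : j ∈ T <;> simp [C, h, u, v]]
    have hprod : (s.map gen).prod * ∏ j, gen (C j) =
        ((s + Finset.univ.val.map C).map gen).prod := by
      rw [Multiset.map_add, Multiset.prod_add, Multiset.map_map]
      rfl
    rw [hprod, degMap_prod_gen, hrWeight]
    simp only [truncRankGE_add_chain hM s C hC, Multiset.card_add, Multiset.card_map,
      Finset.card_val, Finset.card_univ, Fintype.card_fin]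
    rw [Finset.prod_ite_zero]
    simp only [Finset.mem_univ, true_implies, Finset.prod_const_one, ← and_assoc, ite_and]
    split_ifs <;> simp
  rw [Finset.prod_sub, Finset.mul_sum, map_sum]
  have hsum : ∀ T ∈ (Finset.univ : Finset (Fin n)).powerset, degMap hM r ((s.map gen).prod *
      ((-1) ^ T.card * (∏ j ∈ Finset.univ \ T, gen (U j)) * ∏ j ∈ T, gen (V j))) =
      (if card s + n = r ∧ TruncRankGE s ⊥ 0 then 1 else 0) *
        ((-1) ^ T.card * (∏ j ∈ Finset.univ \ T, u j) * ∏ j ∈ T, v j) := by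
    intro T _
    have h1 : ∀ x y z : AugChowRing L, x * ((-1) ^ T.card * y * z) =
        ((-1 : ℤ) ^ T.card) • (x * (y * z)) := by
      intro x y z
      rw [zsmul_eq_mul]
      push_cast
      ring
    rw [h1, map_smul, hterm, smul_eq_mul]
    ring
  rw [Finset.sum_congr rfl hsum, ← Finset.mul_sum, ← Finset.prod_sub]
  have huv : ∀ j, u j - v j = if TruncRankGE s (U j) (j + 1) ∧ ¬ TruncRankGE s (V j) (j + 1)
      then 1 else 0 := by
    intro j
    have := fun h : TruncRankGE s (V j) (j + 1) => h.mono hM (hVU j) le_rfl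
    by_cases h1 : TruncRankGE s (U j) (j + 1) <;> by_cases h2 : TruncRankGE s (V j) (j + 1) <;>
      first | exact absurd (this h2) h1 | simp [u, v, h1, h2]
  simp only [huv]
  rw [Finset.prod_ite_zero]
  simp only [Finset.mem_univ, true_implies, Finset.prod_const_one, ← and_assoc, ite_and]
  split_ifs <;> simp

/-- The chain of pairs `V j ≤ U j` defining the test element of a standard multiset `s`. Here `U j`
is the least member of the completed chain `⊤ ::ₘ s` of rank greater than `j` in the truncation
along `s`, and `V j` is the proper member of rank exactly `j` if there is one, else `⊥`. -/
theorem IsStd.exists_test (hM : IsMatroid L) {s : Multiset L} (hs : IsStd s) {n : ℕ}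
    (hn : card s + n = rk (⊤ : L)) :
    ∃ U V : Fin n → L, (∀ i j, i < j → U i ≤ U j) ∧ (∀ i j, i < j → U i ≤ V j ∨ V j = ⊥) ∧
      (∀ j, V j ≤ U j) ∧ (∀ j : Fin n, TruncRankGE s (U j) (j + 1)) ∧
      (∀ j : Fin n, ¬ TruncRankGE s (V j) (j + 1)) ∧
      ∀ F ∈ s, F ≠ ⊤ → ∃ j, V j = F ∧ rk F = j + below s F := by
  have hfin := hM.finite
  have hU : ∀ j : Fin n, ∃ U ∈ ⊤ ::ₘ s, j + 1 + below s U ≤ rk U ∧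
      ∀ G ∈ ⊤ ::ₘ s, j + 1 + below s G ≤ rk G → U ≤ G := by
    intro j
    obtain ⟨U, ⟨hU, hjU⟩, hmin⟩ := (Set.toFinite
      {F | F ∈ ⊤ ::ₘ s ∧ (j : ℕ) + 1 + below s F ≤ rk F}).exists_minimal
      ⟨⊤, Multiset.mem_cons_self _ _, by rw [below_top]; omega⟩
    exact ⟨U, hU, hjU, fun G hG hjG =>
      (hs.chain_cons_top U hU G hG).elim id fun h => hmin ⟨hG, hjG⟩ h⟩
  choose U hUmem hUrk hUle using hU
  let P : Fin n → L → Prop := fun j F => F ∈ s ∧ F ≠ ⊤ ∧ rk F = j + below s F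
  let V : Fin n → L := fun j => if h : ∃ F, P j F then h.choose else ⊥
  have hV : ∀ j, P j (V j) ∨ V j = ⊥ := by
    intro j
    by_cases h : ∃ F, P j F
    · left; simpa only [V, dif_pos h] using h.choose_spec
    · right; simp only [V, dif_neg h]
  refine ⟨U, V, fun i j hij => hUle i _ (hUmem j) ?_, fun i j hij => (hV j).imp_left fun h =>
    hUle i _ (Multiset.mem_cons_of_mem h.1) ?_, fun j => ?_,
    fun j => hs.truncRankGE hM (hUmem j) (hUrk j), fun j => ?_, fun F hF hFtop => ?_⟩
  · have := hUrk j
    have : (i : ℕ) < j := hij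
    omega
  · have := h.2.2
    have : (i : ℕ) < j := hij
    omega
  · rcases hV j with h | h
    · refine (hs.chain_cons_top _ (Multiset.mem_cons_of_mem h.1) _ (hUmem j)).elim id fun hle => ?_
      rcases hle.eq_or_lt with heq | hlt
      · exact heq.ge
      · have h1 := (Multiset.mem_cons.1 (hUmem j)).resolve_left (ne_top_of_lt hlt)
        have h2 := hs.strict _ h1 _ (Multiset.mem_cons_of_mem h.1) hlt
        have h3 := hUrk j
        have h4 := h.2.2
        omega
    · rw [h]; exact bot_le
  · rcases hV j with h | h
    · refine not_truncRankGE_of_lt ?_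
      have := h.2.2
      omega
    · rw [h]; exact not_truncRankGE_bot (Nat.succ_ne_zero _)
  · have h1 := hs.strict F hF ⊤ (Multiset.mem_cons_self _ _) (lt_top_iff_ne_top.2 hFtop)
    have h2 := hs.below_le F (Multiset.mem_cons_of_mem hF)
    rw [below_top] at h1
    have hj : rk F - below s F < n := by omega
    have hPF : P ⟨_, hj⟩ F := ⟨hF, hFtop, by simp only; omega⟩
    refine ⟨⟨_, hj⟩, ?_, hPF.2.2⟩
    have hPV : P ⟨_, hj⟩ (V ⟨_, hj⟩) := by
      have hex : ∃ F, P ⟨_, hj⟩ F := ⟨F, hPF⟩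
      simpa only [V, dif_pos hex] using hex.choose_spec
    have h3 := hPF.2.2
    have h4 := hPV.2.2
    -- Members of the chain with equal truncated rank coincide.
    rcases hs.chain _ hPV.1 F hF with h | h
    · refine h.eq_of_not_lt fun hlt => ?_
      have := hs.strict _ hPV.1 F (Multiset.mem_cons_of_mem hF) hlt
      omega
    · refine (h.eq_of_not_lt fun hlt => ?_).symm
      have := hs.strict F hF _ (Multiset.mem_cons_of_mem hPV.1) hlt
      omega

/-- If in the truncation along `s'` the members of the standard multiset `s` have rank at most
`rk F - below s F`, which is their rank in the truncation along `s`, then every flat has at most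
the rank in the truncation along `s'` that it has in the truncation along `s`. -/
theorem IsStd.truncRankGE_of_truncRankGE (hM : IsMatroid L) {s s' : Multiset L} (hs : IsStd s)
    (h : ∀ F ∈ s, ∃ t ≤ s', rk (F ⊔ t.sup) + below s F ≤ rk F + card t) {C : L} {n : ℕ}
    (hC : TruncRankGE s' C n) : TruncRankGE s C n := by
  intro t hts
  by_cases ht : t = 0
  · simpa [ht] using hC 0 (Multiset.zero_le _)
  have hF := hs.sup_mem hts ht
  set F := t.sup with hFdef
  obtain ⟨u, hu, hur⟩ := h F hF
  have h1 := hC u hu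
  have h2 := card_le_below hts (le_refl t.sup)
  have h3 := rk_sup_sup_add_le hM C (le_sup_left : F ≤ F ⊔ u.sup)
  have h4 : rk (C ⊔ u.sup) ≤ rk (C ⊔ (F ⊔ u.sup)) :=
    rk_mono hM (sup_le_sup_left le_sup_right _)
  rw [← hFdef] at h2
  omega

/-- Let `s` be standard and let `s'` have the same truncation. A member `F` of `s` is a flat of the
truncation, so any `t ≤ s'` that computes its rank has its join below `F`; counting the members of
`t` bounds `below s F`. -/
theorem IsStd.below_le_below (hM : IsMatroid L) {s s' : Multiset L} (hs : IsStd s)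
    (h : ∀ C n, TruncRankGE s C n ↔ TruncRankGE s' C n) {F : L} (hF : F ∈ s) :
    below s F ≤ below s' F := by
  have hF' : F ∈ ⊤ ::ₘ s := Multiset.mem_cons_of_mem hF
  have hle := hs.below_le F hF'
  have h1 : ¬ TruncRankGE s' F (rk F - below s F + 1) := by
    rw [← h]
    exact not_truncRankGE_of_lt (by omega)
  simp only [TruncRankGE, not_forall, not_le] at h1
  obtain ⟨t, ht, htr⟩ := h1
  by_cases htF : t.sup ≤ F
  · rw [sup_eq_left.2 htF] at htr
    have := card_le_below ht htF
    omega
  · exfalso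
    have h2 : ¬ TruncRankGE s' (F ⊔ t.sup) (rk F - below s F + 1) := by
      intro h3
      have := h3 t ht
      rw [sup_assoc, sup_idem] at this
      omega
    rw [← h] at h2
    refine h2 fun u hu => ?_
    have := (hs.le_rk_sup hM hF' (le_sup_left : F ≤ F ⊔ t.sup) hu).2 hF (left_lt_sup.2 htF)
    omega

theorem exists_greatest_mem_le {s : Multiset L}
    (hchain : ∀ F ∈ s, ∀ G ∈ s, F ≤ G ∨ G ≤ F) {F : L} (hF : 0 < below s F) :
    ∃ G ∈ s, G ≤ F ∧ below s G = below s F := by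
  obtain ⟨t, hts, htF, ht⟩ := exists_le_sup_le_card_eq_below s F
  have ht0 : t ≠ 0 := by rintro rfl; simp at ht; omega
  refine ⟨t.sup, Multiset.mem_of_le hts (sup_mem_of_chain ht0 fun A hA B hB =>
    hchain A (Multiset.mem_of_le hts hA) B (Multiset.mem_of_le hts hB)), htF, ?_⟩
  exact le_antisymm (below_mono s htF) (ht ▸ card_le_below hts le_rfl)

theorem below_pos {L : Type*} [Lattice L] {s : Multiset L} {F : L} (hF : F ∈ s) : 0 < below s F :=
  Multiset.countP_pos.2 ⟨F, hF, le_rfl⟩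

theorem below_lt_of_lt {s : Multiset L} {F G : L} (hF : F ∈ s) (hlt : G < F) :
    below s G < below s F := by
  obtain ⟨t, hts, htG, ht⟩ := exists_le_sup_le_card_eq_below s G
  have hFt : F ∉ t := fun h => hlt.not_ge ((Multiset.le_sup h).trans htG)
  have h1 : F ::ₘ t ≤ s := by
    rw [Multiset.le_iff_count]
    intro A
    by_cases hA : A = F
    · subst hA
      rw [Multiset.count_cons_self, Multiset.count_eq_zero_of_notMem hFt]
      exact Multiset.one_le_count_iff_mem.2 hF
    · rw [Multiset.count_cons_of_ne hA]
      exact Multiset.le_iff_count.1 hts A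
  have h2 := card_le_below h1 (F := F) (by
    rw [Multiset.sup_cons]; exact sup_le le_rfl (htG.trans hlt.le))
  rw [Multiset.card_cons] at h2
  omega

/-- Two multisets of which each has, below each of its members, at most as many members as the
other, have the same members and the same counts there. -/
theorem mem_and_below_eq {s s' : Multiset L}
    (hchain : ∀ F ∈ s', ∀ G ∈ s', F ≤ G ∨ G ≤ F)
    (h : ∀ F ∈ s, below s F ≤ below s' F) (h' : ∀ F ∈ s', below s' F ≤ below s F) {F : L}
    (hF : F ∈ s) : F ∈ s' ∧ below s F = below s' F := by
  obtain ⟨G, hG, hGF, hGb⟩ := exists_greatest_mem_le hchain ((below_pos hF).trans_le (h F hF))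
  have h1 := h F hF
  have h2 := h' G hG
  rcases hGF.eq_or_lt with rfl | hlt
  · exact ⟨hG, by omega⟩
  · have := below_lt_of_lt hF hlt
    omega

/-- A standard multiset is determined by its truncation. -/
theorem IsStd.eq_of_truncRankGE_iff (hM : IsMatroid L) {s s' : Multiset L} (hs : IsStd s)
    (hs' : IsStd s') (h : ∀ C n, TruncRankGE s C n ↔ TruncRankGE s' C n) : s = s' := by
  have hfin := hM.finite
  have hb := fun F hF => hs.below_le_below hM h (F := F) hF
  have hb' := fun F hF => hs'.below_le_below hM (fun C n => (h C n).symm) (F := F) hF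
  have h1 := fun F hF => mem_and_below_eq hs'.chain hb hb' (F := F) hF
  have h2 := fun F hF => mem_and_below_eq hs.chain hb' hb (F := F) hF
  have hcount : ∀ (s : Multiset L) (F : L), below s F = s.count F + s.countP (· < F) := by
    intro s F
    induction s using Multiset.induction_on with
    | empty => simp [below]
    | cons G s ih =>
      simp only [below] at ih
      rw [below, Multiset.countP_cons, Multiset.count_cons, Multiset.countP_cons, ih]
      rcases eq_or_ne F G with rfl | hne
      · simp; omega
      · have : G ≤ F ↔ G < F := ⟨fun h => h.lt_of_ne hne.symm, le_of_lt⟩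
        simp [this, hne]; omega
  ext F
  -- The multiplicity of `F` is determined by `below s F` and the multiplicities of smaller flats.
  induction F using WellFoundedLT.induction with
  | ind F ih =>
  by_cases hF : F ∈ s
  · have h3 := (h1 F hF).2
    have h4 : s.countP (· < F) = s'.countP (· < F) := by
      rw [Multiset.countP_eq_card_filter, Multiset.countP_eq_card_filter]
      congr 1
      ext G
      by_cases hG : G < F
      · simp [hG, ih G hG]
      · simp [hG]
    rw [hcount, hcount] at h3
    omega
  · rw [Multiset.count_eq_zero_of_notMem hF,
      Multiset.count_eq_zero_of_notMem fun hF' => hF (h2 F hF').1]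

end Test

/-! ### Unitriangular pairings -/

section Triangular

variable {ι M : Type*} [PartialOrder ι] [AddCommGroup M]

/-- A family is independent if functionals detect it through a unitriangular matrix: a relation
fails at a minimal index of its support. -/
theorem linearIndependent_of_unitriangular {v : ι → M} {φ : ι → M →ₗ[ℤ] ℤ}
    (hdiag : ∀ i, φ i (v i) = 1) (htri : ∀ i j, φ i (v j) ≠ 0 → j ≤ i) :
    LinearIndependent ℤ v := by
  classical
  rw [linearIndependent_iff']
  intro s g hg
  by_contra! hne
  obtain ⟨i₀, hi₀, hgi₀⟩ := hne
  obtain ⟨i, hi, hmin⟩ := (s.filter fun i => g i ≠ 0).exists_minimal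
    ⟨i₀, Finset.mem_filter.2 ⟨hi₀, hgi₀⟩⟩
  obtain ⟨his, hgi⟩ := Finset.mem_filter.1 hi
  have h := congrArg (φ i) hg
  rw [map_sum, map_zero, Finset.sum_eq_single_of_mem i his, map_smul, hdiag, smul_eq_mul,
    mul_one] at h
  · exact hgi h
  · intro j hj hji
    rw [map_smul, smul_eq_mul]
    by_contra hne
    obtain ⟨h1, h2⟩ := mul_ne_zero_iff.1 hne
    have hle := htri i j h2
    exact hji (le_antisymm hle (hmin (Finset.mem_filter.2 ⟨hj, h1⟩) hle))

theorem exists_eq_of_unitriangular [Finite ι] {v : ι → M} {φ : ι → M →ₗ[ℤ] ℤ}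
    (hdiag : ∀ i, φ i (v i) = 1) (htri : ∀ i j, φ i (v j) ≠ 0 → j ≤ i) (w : ι → ℤ) :
    ∃ x, ∀ i, φ i x = w i := by
  classical
  have := Fintype.ofFinite ι
  -- Forward substitution along the order.
  obtain ⟨c, hc⟩ : ∃ c : ι → ℤ, ∀ i, c i = w i - ∑ j, if j < i then c j * φ i (v j) else 0 := by
    let step : ∀ i, (∀ j, j < i → ℤ) → ℤ := fun i c =>
      w i - ∑ j, if h : j < i then c j h * φ i (v j) else 0
    refine ⟨(wellFounded_lt (α := ι)).fix step, fun i => ?_⟩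
    rw [WellFounded.fix_eq]
    simp only [step, dite_eq_ite]
  refine ⟨∑ j, c j • v j, fun i => ?_⟩
  have h : ∀ j, φ i (c j • v j) =
      (if j = i then c i else 0) + if j < i then c j * φ i (v j) else 0 := by
    intro j
    rw [map_smul, smul_eq_mul]
    by_cases hji : j = i
    · subst hji; simp [hdiag]
    · by_cases hlt : j < i
      · simp [hji, hlt]
      · have : φ i (v j) = 0 := by
          by_contra hne
          exact hlt ((htri i j hne).lt_of_ne hji)
        simp [hji, hlt, this]
  rw [map_sum, Finset.sum_congr rfl fun j _ => h j, Finset.sum_add_distrib,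
    Finset.sum_ite_eq' Finset.univ i, if_pos (Finset.mem_univ _), hc i]
  ring

end Triangular

/-! ### Bases and duality -/

section Duality

variable {L : Type*} [Lattice L] [BoundedOrder L]

theorem gen_mem_augChowGrade (F : L) : gen F ∈ augChowGrade L 1 := by
  by_cases hF : F = ⊥
  · rw [hF, gen_bot]; exact zero_mem _
  · rw [show gen F = h ⟨F, hF⟩ from gen_coe ⟨F, hF⟩]
    exact ⟨_, MvPolynomial.isHomogeneous_X ℤ _, rfl⟩

theorem one_mem_augChowGrade : (1 : AugChowRing L) ∈ augChowGrade L 0 :=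
  ⟨1, MvPolynomial.isHomogeneous_one _ _, rfl⟩

theorem prod_mem_augChowGrade {n : ℕ} (f : Fin n → AugChowRing L)
    (hf : ∀ i, f i ∈ augChowGrade L 1) : ∏ i, f i ∈ augChowGrade L n := by
  induction n with
  | zero => simpa using one_mem_augChowGrade
  | succ n ih =>
    have hmul := mul_mem_augChowGrade (hf 0) (ih (fun i => f i.succ) fun i => hf _)
    rw [Nat.add_comm 1 n] at hmul
    rwa [Fin.prod_univ_succ]

theorem flats_injective : Function.Injective (flats : (NonemptyFlat L →₀ ℕ) → Multiset L) := by
  classical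
  exact (Multiset.map_injective Subtype.val_injective).comp
    (Function.LeftInverse.injective Finsupp.toMultiset_toFinsupp)

/-- The test element of a standard monomial `m`. If a monomial `m'` pairs nontrivially with it, then
the rank function of the truncation along `m'` is at most that of the truncation along `m`. -/
theorem exists_testElement (hM : IsMatroid L) {k l : ℕ} (hkl : k + l = rk (⊤ : L))
    {m : NonemptyFlat L →₀ ℕ} (hm : IsStandard m) (hk : m.degree = k) :
    ∃ x ∈ augChowGrade L l, degMap hM (rk (⊤ : L)) (hMonomial m * x) = 1 ∧
      ∀ m' : NonemptyFlat L →₀ ℕ, degMap hM (rk (⊤ : L)) (hMonomial m' * x) ≠ 0 →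
        ∀ C n, TruncRankGE (flats m') C n → TruncRankGE (flats m) C n := by
  classical
  have hs := hm.isStd hM
  have hcard : card (flats m) + l = rk (⊤ : L) := by rw [card_flats, hk, hkl]
  obtain ⟨U, V, hUU, hUV, hVU, hU, hV, hF⟩ := hs.exists_test hM hcard
  refine ⟨∏ j, (gen (U j) - gen (V j)), prod_mem_augChowGrade _ fun j =>
    sub_mem (gen_mem_augChowGrade _) (gen_mem_augChowGrade _), ?_, fun m' hm' C n hC => ?_⟩
  · rw [hMonomial_eq_prod_gen, degMap_mul_prod_sub hM _ _ hUU hUV hVU,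
      if_pos ⟨hcard, hs.hallRado, fun j => ⟨hU j, hV j⟩⟩]
  · rw [hMonomial_eq_prod_gen, degMap_mul_prod_sub hM _ _ hUU hUV hVU] at hm'
    obtain ⟨h1, -, h2⟩ := not_not.1 fun h => hm' (if_neg h)
    refine hs.truncRankGE_of_truncRankGE hM (fun F hFs => ?_) hC
    by_cases hFtop : F = ⊤
    · refine ⟨flats m', le_rfl, ?_⟩
      rw [hFtop, top_sup_eq, below_top]
      omega
    · obtain ⟨j, hVj, hj⟩ := hF F hFs hFtop
      have h3 := (h2 j).2
      rw [hVj] at h3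
      simp only [TruncRankGE, not_forall, not_le] at h3
      obtain ⟨t, ht, htr⟩ := h3
      exact ⟨t, ht, by omega⟩

/-- The rank function of the truncation along a monomial, encoded by the set of pairs `(C, n)` such
that `C` has rank at least `n`. Inclusion of these sets is the pointwise order of rank functions. -/
def truncGraph (m : NonemptyFlat L →₀ ℕ) : Set (L × ℕ) := {p | TruncRankGE (flats m) p.1 p.2}

theorem truncGraph_injOn (hM : IsMatroid L) :
    Set.InjOn truncGraph {m : NonemptyFlat L →₀ ℕ | IsStandard m} := by
  intro m hm m' hm' h
  exact flats_injective ((hm.isStd hM).eq_of_truncRankGE_iff hM (hm'.isStd hM) fun C n =>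
    Set.ext_iff.1 h (C, n))

theorem linearIndependent_hMonomial (hM : IsMatroid L) :
    LinearIndependent ℤ fun m : {m : NonemptyFlat L →₀ ℕ // IsStandard m} => hMonomial m.1 := by
  have hex : ∀ m : {m : NonemptyFlat L →₀ ℕ // IsStandard m}, _ := fun m =>
    exists_testElement hM (k := m.1.degree) (l := rk (⊤ : L) - m.1.degree) (by
      have := (m.2.isStd hM).below_le ⊤ (Multiset.mem_cons_self _ _)
      rw [below_top, card_flats] at this
      omega) m.2 rfl
  choose x _ hdiag htri using hex
  let _ : PartialOrder {m : NonemptyFlat L →₀ ℕ // IsStandard m} :=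
    PartialOrder.lift (fun m => truncGraph m.1) fun m m' h =>
      Subtype.ext (truncGraph_injOn hM m.2 m'.2 h)
  exact linearIndependent_of_unitriangular
    (φ := fun m => degMap hM (rk (⊤ : L)) ∘ₗ LinearMap.mulRight ℤ (x m)) hdiag
    fun m m' hne => show truncGraph m'.1 ⊆ truncGraph m.1 from
      fun p hp => htri m m'.1 hne p.1 p.2 hp

/-- The standard monomials of degree `k`. -/
abbrev StdMonomial (L : Type*) [Lattice L] [BoundedOrder L] (k : ℕ) : Type _ :=
  {m : NonemptyFlat L →₀ ℕ // IsStandard m ∧ m.degree = k}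

theorem finite_stdMonomial (hM : IsMatroid L) (k : ℕ) : Finite (StdMonomial L k) := by
  have := hM.finite
  exact Set.Finite.subset (Finsupp.finite_of_degree_le k) fun _ h => h.2.le

/-- A standard monomial of degree `k` as an element of the graded piece. -/
def StdMonomial.toGrade {k : ℕ} (m : StdMonomial L k) : augChowGrade L k :=
  ⟨hMonomial m.1, by
    have hmem := hMonomial_mem_augChowGrade m.1
    rwa [m.2.2] at hmem⟩

/-- The basis of standard monomials of a graded piece. -/
def stdBasis (hM : IsMatroid L) (k : ℕ) :
    Module.Basis (StdMonomial L k) ℤ (augChowGrade L k) :=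
  Module.Basis.mk (v := StdMonomial.toGrade)
    (LinearIndependent.of_comp (augChowGrade L k).subtype
      ((linearIndependent_hMonomial hM).comp
        (fun m : StdMonomial L k => (⟨m.1, m.2.1⟩ : {m // IsStandard m}))
        fun _ _ h => Subtype.ext (Subtype.mk.inj h)))
    (by
      rintro ⟨x, hx⟩ -
      have hmap : x ∈ (Submodule.span ℤ (Set.range (StdMonomial.toGrade (L := L) (k := k)))).map
          (augChowGrade L k).subtype := by
        rw [Submodule.map_span, ← Set.range_comp]
        rw [augChowGrade_eq_stdSpan hM] at hx
        refine Submodule.span_mono ?_ hx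
        rintro _ ⟨m, hm, rfl⟩
        exact ⟨⟨m, hm⟩, rfl⟩
      obtain ⟨y, hy, rfl⟩ := hmap
      exact hy)

/-- The degree functional on the top graded piece. -/
def gradeDeg (hM : IsMatroid L) : augChowGrade L (rk (⊤ : L)) →ₗ[ℤ] ℤ :=
  (degMap hM (rk (⊤ : L))).domRestrict _

/-- Evaluating functionals on `A^l` at the test elements of the standard monomials of degree `k`
gives a map `g` whose composite with the pairing is surjective, since on standard monomials it is
unitriangular. -/
theorem exists_dual_section (hM : IsMatroid L) {k l : ℕ} (hkl : k + l = rk (⊤ : L)) :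
    ∃ g : (augChowGrade L l →ₗ[ℤ] ℤ) →ₗ[ℤ] (StdMonomial L k → ℤ),
      Function.Surjective (g ∘ₗ degPairing (gradeDeg hM) hkl) := by
  have hfin := finite_stdMonomial hM k
  choose x hx hdiag htri using fun m : StdMonomial L k => exists_testElement hM hkl m.2.1 m.2.2
  let _ : PartialOrder (StdMonomial L k) :=
    PartialOrder.lift (fun m => truncGraph m.1) fun m m' h =>
      Subtype.ext (truncGraph_injOn hM m.2.1 m'.2.1 h)
  let g : (augChowGrade L l →ₗ[ℤ] ℤ) →ₗ[ℤ] (StdMonomial L k → ℤ) :=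
    LinearMap.pi fun m => LinearMap.applyₗ ⟨x m, hx m⟩
  refine ⟨g, fun w => ?_⟩
  obtain ⟨a, ha⟩ := exists_eq_of_unitriangular (v := StdMonomial.toGrade (L := L) (k := k))
    (φ := fun m => LinearMap.applyₗ (⟨x m, hx m⟩ : augChowGrade L l) ∘ₗ
      degPairing (gradeDeg hM) hkl) hdiag
    (fun m m' hne => show truncGraph m'.1 ⊆ truncGraph m.1 from
      fun p hp => htri m m'.1 hne p.1 p.2 hp) w
  exact ⟨a, funext ha⟩

/-- The surjection onto `ℤ^(StdMonomial L k)` from the dual of the free module `A^l` compares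
ranks. -/
theorem card_stdMonomial_le (hM : IsMatroid L) {k l : ℕ} (hkl : k + l = rk (⊤ : L)) :
    Nat.card (StdMonomial L k) ≤ Nat.card (StdMonomial L l) := by
  have := finite_stdMonomial hM k
  have := finite_stdMonomial hM l
  have := Fintype.ofFinite (StdMonomial L k)
  have := Fintype.ofFinite (StdMonomial L l)
  obtain ⟨g, hg⟩ := exists_dual_section hM hkl
  have hsurj : Function.Surjective (g ∘ₗ ((stdBasis hM l).constr ℤ (M' := ℤ)).toLinearMap) :=
    (Function.Surjective.of_comp (g := degPairing (gradeDeg hM) hkl) hg).comp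
      (LinearEquiv.surjective _)
  rw [Nat.card_eq_fintype_card, Nat.card_eq_fintype_card]
  exact card_le_of_surjective ℤ _ hsurj

theorem bijective_degPairing (hM : IsMatroid L) {k l : ℕ} (hkl : k + l = rk (⊤ : L)) :
    Function.Bijective (degPairing (gradeDeg hM) hkl) := by
  have hk := finite_stdMonomial hM k
  have hl := finite_stdMonomial hM l
  obtain ⟨g, hg⟩ := exists_dual_section hM hkl
  have hcard : Nat.card (StdMonomial L k) = Nat.card (StdMonomial L l) :=
    le_antisymm (card_stdMonomial_le hM hkl) (card_stdMonomial_le hM (by omega))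
  obtain ⟨e⟩ : Nonempty (StdMonomial L k ≃ StdMonomial L l) := Finite.card_eq.1 hcard
  -- Both `g` and its composite with the pairing are surjections between free modules of equal
  -- finite rank, hence injective.
  have hcomp : Function.Injective (g ∘ₗ degPairing (gradeDeg hM) hkl) := by
    let b := (stdBasis hM k).equivFun
    have := OrzechProperty.injective_of_surjective_endomorphism
      ((g ∘ₗ degPairing (gradeDeg hM) hkl) ∘ₗ b.symm.toLinearMap) (hg.comp b.symm.surjective)
    intro x y hxy
    refine b.injective (this ?_)
    simpa using hxy
  have hginj : Function.Injective g := by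
    let c : (StdMonomial L k → ℤ) ≃ₗ[ℤ] (augChowGrade L l →ₗ[ℤ] ℤ) :=
      (LinearEquiv.funCongrLeft ℤ ℤ e.symm).trans ((stdBasis hM l).constr ℤ (M' := ℤ))
    have := OrzechProperty.injective_of_surjective_endomorphism (g ∘ₗ c.toLinearMap)
      ((Function.Surjective.of_comp (g := degPairing (gradeDeg hM) hkl) hg).comp c.surjective)
    intro x y hxy
    refine c.symm.injective (this ?_)
    simpa using hxy
  refine ⟨Function.Injective.of_comp hcomp, fun φ => ?_⟩
  obtain ⟨a, ha⟩ := hg (g φ)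
  exact ⟨a, hginj ha⟩

theorem gradeDeg_prod_h (hM : IsMatroid L) (F : Fin (rk (⊤ : L)) → NonemptyFlat L) :
    (HallRado F → gradeDeg hM ⟨∏ i, h (F i), prod_h_mem_augChowGrade F⟩ = 1) ∧
    (¬ HallRado F → gradeDeg hM ⟨∏ i, h (F i), prod_h_mem_augChowGrade F⟩ = 0) := by
  -- Two expressions for the same product, over `Fin r` and over the multiset of flats.
  have hdeg : gradeDeg hM ⟨∏ i, h (F i), prod_h_mem_augChowGrade F⟩ =
      hrWeight (rk (⊤ : L)) (Finset.univ.val.map fun i => (F i).1) := by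
    rw [← degMap_prod_gen hM, Multiset.map_map]
    change degMap hM _ (∏ i, h (F i)) = degMap hM _ (∏ i, gen (F i).1)
    simp only [gen_coe]
  rw [hdeg, hrWeight, hallRado_iff]
  exact ⟨fun h => if_pos ⟨by simp, h⟩, fun h => if_neg fun h' => h h'.2⟩

theorem mem_augChowGrade_zero (hM : IsMatroid L) {x : AugChowRing L} (hx : x ∈ augChowGrade L 0) :
    ∃ n : ℤ, x = n • 1 := by
  rw [augChowGrade_eq_stdSpan hM, stdSpan] at hx
  have : hMonomial '' {m : NonemptyFlat L →₀ ℕ | IsStandard m ∧ m.degree = 0} ⊆ {1} := by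
    rintro _ ⟨m, ⟨-, hm⟩, rfl⟩
    rw [Finsupp.degree_eq_zero_iff] at hm
    simp [hm, hMonomial]
  obtain ⟨n, hn⟩ := Submodule.mem_span_singleton.1 (Submodule.span_mono this hx)
  exact ⟨n, hn.symm⟩

theorem bijective_gradeDeg (hM : IsMatroid L) : Function.Bijective (gradeDeg hM) := by
  constructor
  · -- As `A^0` consists of the integers, `A^r` embeds into the dual of `ℤ`.
    rw [injective_iff_map_eq_zero]
    intro a ha
    refine (bijective_degPairing hM (add_zero (rk (⊤ : L)))).1 ?_
    rw [map_zero]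
    ext ⟨b, hb⟩
    obtain ⟨n, rfl⟩ := mem_augChowGrade_zero hM hb
    change degMap hM _ (a.1 * n • 1) = 0
    rw [mul_smul_comm, mul_one, map_smul, show degMap hM _ a.1 = 0 from ha, smul_zero]
  · -- The product of `r` copies of `h_⊤` has degree one.
    have hne : ∀ _ : Fin (rk (⊤ : L)), (⊤ : L) ≠ ⊥ := by
      intro i h
      have h0 : rk (⊤ : L) = 0 := h ▸ rk_bot
      have := i.2
      omega
    have hHR : HallRado fun i => (⟨⊤, hne i⟩ : NonemptyFlat L) := by
      intro T
      rcases T.eq_empty_or_nonempty with rfl | hT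
      · simp
      · rw [Finset.sup_const hT]
        exact (Finset.card_le_univ T).trans (by simp)
    intro n
    refine ⟨n • ⟨_, prod_h_mem_augChowGrade fun i => ⟨⊤, hne i⟩⟩, ?_⟩
    rw [map_smul, (gradeDeg_prod_h hM _).1 hHR, smul_eq_mul, mul_one]

end Duality

end LatticeMatroid

end

theorem theorem1p2 {L : Type*} [Lattice L] [BoundedOrder L]
    (hM : LatticeMatroid.IsMatroid L) (r : ℕ) (hr : LatticeMatroid.rk (⊤ : L) = r) :
    -- (SM)
    (∃ b : Module.Basis {m : LatticeMatroid.NonemptyFlat L →₀ ℕ // LatticeMatroid.IsStandard m}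
        ℤ (LatticeMatroid.AugChowRing L),
      ∀ m, b m = LatticeMatroid.hMonomial m.1) ∧
    ∃ deg : LatticeMatroid.augChowGrade L r ≃ₗ[ℤ] ℤ,
      -- (HR)
      (∀ F : Fin r → LatticeMatroid.NonemptyFlat L,
        (LatticeMatroid.HallRado F →
          deg ⟨∏ i, LatticeMatroid.h (F i), LatticeMatroid.prod_h_mem_augChowGrade F⟩ = 1) ∧
        (¬ LatticeMatroid.HallRado F →
          deg ⟨∏ i, LatticeMatroid.h (F i), LatticeMatroid.prod_h_mem_augChowGrade F⟩ = 0)) ∧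
      -- (PD)
      (∀ (k l : ℕ) (hkl : k + l = r),
        Function.Bijective (LatticeMatroid.degPairing deg.toLinearMap hkl)) := by
  subst hr
  refine ⟨⟨Module.Basis.mk (LatticeMatroid.linearIndependent_hMonomial hM) ?_,
    fun m => Module.Basis.mk_apply _ _ _⟩,
    LinearEquiv.ofBijective (LatticeMatroid.gradeDeg hM) (LatticeMatroid.bijective_gradeDeg hM),
    LatticeMatroid.gradeDeg_prod_h hM,
    fun k l hkl => LatticeMatroid.bijective_degPairing hM hkl⟩
  rw [← LatticeMatroid.span_standard_eq_top hM, Set.image_eq_range]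
  rfl
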